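/- Let $q$ be an odd prime power and let $r\ge 4$ be even. Let $Q$ be a non-degenerate quadratic form on $\mathbb F_q^{\,r+1}$ with polar form $B(x,y)=Q(x+y)-Q(x)-Q(y)$, let $\Sigma=\mathrm{PG}(r,q)$ be embedded coordinatewise in $\mathrm{PG}(r,q^2)$, and let $\mathcal Q(r,q)=\{\langle v\rangle\in\Sigma : Q(v)=0\}$ be the associated parabolic quadric. Extend $B$ to a bilinear form on $\mathbb F_{q^2}^{\,r+1}$, let $\tau(x_0,\dots,x_r)=(x_0^q,\dots,x_r^q)$, and let $$\mathcal H(r,q^2)=\{\langle x\rangle\in \mathrm{PG}(r,q^2) : B(\tau(x),x)=0\},$$ the non-degenerate Hermitian variety whose unitary polarity is the product of the orthogonal polarity of $B$ and $\tau$. For a line $\ell$ of $\Sigma$, its extended line $\bar\ell$ is the line of $\mathrm{PG}(r,q^2)$ spanned by $\ell$. Let $G\cong\mathrm{PGO}(r+1,q)$ be the group of projectivities of $\Sigma$ induced by the similitudes of $Q$ (the invertible linear maps $g$ such that $Q\circ g=cQ$ for some $c\in\mathbb F_q^*$), regarded as a group of projectivities of $\mathrm{PG}(r,q^2)$. Then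 $G$ leaves $\mathcal H(r,q^2)$ invariant and has exactly four orbits on the points of $\mathcal H(r,q^2)$, namely: 1. $\mathcal Q(r,q)$; 2. $\mathcal O$, the set of points of $\mathrm{PG}(r,q^2)\setminus\Sigma$ lying on an extended line $\bar\ell$, where $\ell$ is a line of $\Sigma$ contained in $\mathcal Q(r,q)$; 3. $\mathcal E$, the set of points of $\mathcal H(r,q^2)$ lying on an extended line $\bar\ell$, where $\ell$ is a line of $\Sigma$ having no point in common with $\mathcal Q(r,q)$; 4. $\mathcal S$, the set of points of $\mathcal H(r,q^2)\setminus\mathcal Q(r,q)$ lying on an extended line $\bar\ell$, where $\ell$ is a line of $\Sigma$ meeting $\mathcal Q(r,q)$ in exactly two points. Moreover $|\mathcal S|=|\mathcal E|=q^{r-1}(q^r-1)/2$. -/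

import Mathlib

open scoped LinearAlgebra.Projectivization MatrixGroups

namespace ParabolicHermitian

noncomputable section

universe u v

variable {F : Type u} [Field F] {n : ℕ}

/-- The points of `PG(n - 1, F)` on the quadric `Q = 0`. -/
def quadric (Q : QuadraticForm F (Fin n → F)) : Set (ℙ F (Fin n → F)) :=
  {P | ∀ v ∈ P.submodule, Q v = 0}

/-- A submodule is a projective line when it has vector space dimension two. -/
def IsLine (l : Submodule F (Fin n → F)) : Prop := Module.finrank F l = 2

/-- The points of `PG(n - 1, F)` on a projective subspace. -/
def points (l : Submodule F (Fin n → F)) : Set (ℙ F (Fin n → F)) :=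
  {P | P ∈ l.projectivization}

/-- The group of similitudes of `Q`: invertible matrices multiplying `Q` by a nonzero scalar. -/
def similitudeGroup (Q : QuadraticForm F (Fin n → F)) : Subgroup (GL (Fin n) F) where
  carrier := {g | ∃ c : Fˣ, ∀ v, Q (g.1.mulVec v) = c * Q v}
  one_mem' := ⟨1, by simp⟩
  mul_mem' := by
    rintro a b ⟨c, hc⟩ ⟨d, hd⟩
    refine ⟨c * d, fun v => ?_⟩
    have h := hc (b.1.mulVec v)
    rw [Matrix.mulVec_mulVec] at h
    rw [Units.val_mul, h, hd, Units.val_mul, mul_assoc]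
  inv_mem' := by
    rintro a ⟨c, hc⟩
    refine ⟨c⁻¹, fun v => ?_⟩
    have h := hc ((a⁻¹).1.mulVec v)
    rw [Matrix.mulVec_mulVec, ← Units.val_mul, mul_inv_cancel, Units.val_one,
      Matrix.one_mulVec] at h
    rw [h, ← mul_assoc, Units.inv_mul, one_mul]

/-- `PGO(Q)`: the projectivities of `PG(n - 1, F)` induced by the similitudes of `Q`. -/
def PGO (Q : QuadraticForm F (Fin n → F)) : Subgroup PGL(n, F) :=
  (similitudeGroup Q).map Matrix.ProjGenLinGroup.mk

variable (K : Type v) [Field K] [Algebra F K]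

/-- Coordinatewise inclusion of `F ^ n` into `K ^ n`, semilinear over `F → K`. -/
def incl : (Fin n → F) →ₛₗ[algebraMap F K] (Fin n → K) where
  toFun v i := algebraMap F K (v i)
  map_add' x y := by ext i; simp
  map_smul' c x := by ext i; simp

theorem incl_injective : Function.Injective (incl (F := F) (n := n) K) := by
  intro x y h
  ext i
  exact (algebraMap F K).injective (congrFun h i)

/-- The embedding of `PG(n - 1, F)` in `PG(n - 1, K)`. -/
def embed : ℙ F (Fin n → F) → ℙ K (Fin n → K) :=
  Projectivization.map (incl K) (incl_injective K)

/-- The subspace of `PG(n - 1, K)` extending a subspace of `PG(n - 1, F)`. -/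
def extend (l : Submodule F (Fin n → F)) : Submodule K (Fin n → K) :=
  Submodule.span K (incl K '' (l : Set (Fin n → F)))

variable (F n) in
/-- A projectivity of `PG(n - 1, F)`, considered as a projectivity of `PG(n - 1, K)`. -/
def extendPGL : PGL(n, F) →* PGL(n, K) :=
  Matrix.ProjGenLinGroup.lift
    (Matrix.ProjGenLinGroup.mk.comp (Matrix.GeneralLinearGroup.map (algebraMap F K))) (by
      ext c
      have h : Matrix.GeneralLinearGroup.map (algebraMap F K)
          (Matrix.GeneralLinearGroup.scalar (Fin n) c) =
          Matrix.GeneralLinearGroup.scalar (Fin n) (Units.map (algebraMap F K).toMonoidHom c) := by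
        ext i j
        by_cases hij : i = j
        · subst hij
          simp [Matrix.GeneralLinearGroup.map, Matrix.GeneralLinearGroup.scalar]
        · simp [Matrix.GeneralLinearGroup.map, Matrix.GeneralLinearGroup.scalar, hij]
      simp [h])

/-- The group `G`: `PGO(Q)` considered as a group of projectivities of `PG(n - 1, K)`. -/
def groupG (Q : QuadraticForm F (Fin n → F)) : Subgroup PGL(n, K) :=
  (PGO Q).map (extendPGL F n K)

/-- The `K`-bilinear extension to `K ^ n` of the polar form `Q (x + y) - Q x - Q y`. -/
def polarExt (Q : QuadraticForm F (Fin n → F)) : LinearMap.BilinForm K (Fin n → K) :=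
  Matrix.toBilin' ((LinearMap.BilinForm.toMatrix' Q.polarBilin).map (algebraMap F K))

variable (F) in
/-- The map `τ`, raising each coordinate to the power `q = |F|`. When `|K| = q ^ 2`, this induces
the semilinear involution of `PG(n - 1, K)` fixing `PG(n - 1, F)` pointwise. -/
def tau (x : Fin n → K) : Fin n → K := fun i => x i ^ Nat.card F

/-- The Hermitian form `h (x, y) = B (τ x, y)`, with `B` the polar form of `Q` over `K`. Its
polarity is `τ` followed by the orthogonal polarity of `Q`. -/
def hermForm (Q : QuadraticForm F (Fin n → F)) (x y : Fin n → K) : K :=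
  polarExt K Q (tau F K x) y

/-- The Hermitian variety of the form `hermForm`. -/
def hermitian (Q : QuadraticForm F (Fin n → F)) : Set (ℙ K (Fin n → K)) :=
  {P | ∀ v ∈ P.submodule, hermForm K Q v v = 0}

/-- The quadric `Q = 0` of `PG(n - 1, F)`, as a set of points of `PG(n - 1, K)`. -/
def setQ (Q : QuadraticForm F (Fin n → F)) : Set (ℙ K (Fin n → K)) :=
  embed K '' quadric Q

/-- Points outside `PG(n - 1, F)` on extended lines of the quadric. -/
def setO (Q : QuadraticForm F (Fin n → F)) : Set (ℙ K (Fin n → K)) :=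
  {P | P ∉ Set.range (embed (F := F) (n := n) K) ∧
    ∃ l, IsLine l ∧ points l ⊆ quadric Q ∧ P ∈ points (extend K l)}

/-- Points of the Hermitian variety on extended lines of `PG(n - 1, F)` external to the quadric. -/
def setE (Q : QuadraticForm F (Fin n → F)) : Set (ℙ K (Fin n → K)) :=
  {P | P ∈ hermitian K Q ∧
    ∃ l, IsLine l ∧ points l ∩ quadric Q = ∅ ∧ P ∈ points (extend K l)}

/-- Points of the Hermitian variety off the quadric of `PG(n - 1, F)`, on extended lines
of `PG(n - 1, F)` meeting that quadric in exactly two points. -/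
def setS (Q : QuadraticForm F (Fin n → F)) : Set (ℙ K (Fin n → K)) :=
  {P | P ∈ hermitian K Q \ setQ K Q ∧
    ∃ l, IsLine l ∧ (points l ∩ quadric Q).ncard = 2 ∧ P ∈ points (extend K l)}

end

end ParabolicHermitian

/-! Write `K = F(e)` with `e ^ 2 = d` a nonsquare of `F` and `e ^ q = -e`. Every vector of `K ^ n`
is uniquely `comb e u v = u + e v`, and its point lies on the Hermitian variety iff `Q u = d * Q v`.
Off the subgeometry, the only line of `PG(r, q)` whose extension contains the point is the span of
`u` and `v`, so everything is read off from `disc Q u v = polar Q u v ^ 2 - 4 * Q u * Q v`. Given `Q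
u = d * Q v`, the point is in `setQ` iff `u, v` are dependent, in `setO` iff they are independent
with `disc = 0`, in `setS` iff `disc` is a nonzero square, and in `setE` iff `disc` is a nonsquare.
Similitudes multiply `disc` by a nonzero square, so the four sets are invariant.

Transitivity is Witt's theorem, proved here by reflections for the configurations that occur. For
`setS` and `setE` a rescaling comes first (`IsQuadGen.exists_smul_comb_eq`): multiplying `x = u + e
v` by `z` multiplies `B(x, x)` by `z ^ 2`, the norm of `B(x, x)` to `F` is `-4 * d * disc`, and an
element of `K` is a square iff its norm is. So discriminants in the same square class permit a
common value of `B(x, x)`, which together with `Q u = d * Q v` fixes the Gram matrix.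

The sizes come from counting pairs `(u, v)`. A point of `setS` has exactly two representatives that
are hyperbolic pairs with `polar Q u v = 1`, while each point of `setE ∪ setS` has `q ^ 2 - 1`
representatives in all; `setE` is then found by subtraction. -/

namespace ParabolicHermitian

/-! ### Number of solutions of `Q x = c` in odd dimension. -/

section Counting

open Finset

variable {F : Type*} [Field F] [Fintype F] [DecidableEq F]

theorem card_mul_sq_eq (hF : ringChar F ≠ 2) {a : F} (ha : a ≠ 0) (c : F) :
    (#{x : F | a * x ^ 2 = c} : ℤ) = 1 + quadraticChar F a * quadraticChar F c := by
  have h := quadraticChar_card_sqrts hF (a * c / a ^ 2)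
  have h2 : quadraticChar F (a * c / a ^ 2) = quadraticChar F a * quadraticChar F c := by
    rw [div_eq_mul_inv, ← inv_pow, map_mul, quadraticChar_sq_one' (inv_ne_zero ha), mul_one,
      map_mul]
  rw [h2] at h
  rw [add_comm, ← h]
  congr 2
  ext x
  simp only [mem_filter, mem_univ, true_and, Set.mem_toFinset, Set.mem_ofPred_eq]
  rw [eq_div_iff (pow_ne_zero 2 ha)]
  constructor
  · rintro rfl; ring
  · intro h; apply mul_left_cancel₀ ha; linear_combination h

theorem sum_mul_sq (hF : ringChar F ≠ 2)
    (f : F → ℤ) {a : F} (ha : a ≠ 0) :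
    ∑ x, f (a * x ^ 2) = ∑ y, (1 + quadraticChar F a * quadraticChar F y) * f y := by
  rw [← Finset.sum_fiberwise (s := univ) (g := fun x : F => a * x ^ 2)]
  refine Finset.sum_congr rfl fun y _ => ?_
  rw [← card_mul_sq_eq hF ha y, ← nsmul_eq_mul, ← Finset.sum_const]
  refine Finset.sum_congr rfl fun x hx => ?_
  rw [(mem_filter.1 hx).2]

/-- For `c ≠ 0`, the substitution `y ↦ c * y` reduces to `c = 1`, because the character of `c`
squares to one; what remains is the Jacobi sum of the quadratic character with its inverse, itself.
-/
theorem sum_quadraticChar_mul_sub (hF : ringChar F ≠ 2) (c : F) :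
    ∑ y, quadraticChar F y * quadraticChar F (c - y) =
      quadraticChar F (-1) * (if c = 0 then (Fintype.card F : ℤ) - 1 else -1) := by
  split_ifs with hc
  · subst hc
    have : ∀ y : F, quadraticChar F y * quadraticChar F (0 - y) =
        quadraticChar F (-1) * (1 - if y = 0 then 1 else 0) := by
      intro y
      split_ifs with hy
      · simp [hy]
      · rw [show 0 - y = -1 * y by ring, map_mul, mul_left_comm, ← sq, quadraticChar_sq_one hy]
        simp
    simp only [this, ← mul_sum, sum_sub_distrib]
    simp
  · have h := jacobiSum_nontrivial_inv (quadraticChar_ne_one hF)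
    rw [(quadraticChar_isQuadratic F).inv, jacobiSum] at h
    rw [mul_neg_one, ← h, ← Equiv.sum_comp (Equiv.mulLeft₀ c hc)]
    refine sum_congr rfl fun y _ => ?_
    simp only [Equiv.mulLeft₀_apply]
    rw [show c - c * y = c * (1 - y) by ring, map_mul, map_mul]
    linear_combination quadraticChar F y * quadraticChar F (1 - y) * quadraticChar_sq_one hc

theorem sum_quadraticChar_sub_mul_sq (hF : ringChar F ≠ 2) {a : F} (ha : a ≠ 0) (c : F) :
    ∑ x, quadraticChar F (c - a * x ^ 2) =
      quadraticChar F (-a) * (if c = 0 then (Fintype.card F : ℤ) - 1 else -1) := by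
  rw [sum_mul_sq hF (fun y => quadraticChar F (c - y)) ha]
  have h0 : ∑ y, quadraticChar F (c - y) = 0 := by
    rw [← quadraticChar_sum_zero hF, ← Equiv.sum_comp (Equiv.subLeft c)]
    simp
  simp only [add_mul, one_mul, sum_add_distrib, h0, zero_add, mul_assoc]
  rw [← mul_sum, sum_quadraticChar_mul_sub hF, neg_eq_neg_one_mul a, map_mul]
  ring

/-- The number of representations of `c` by a diagonal form. -/
def diagCount {n : ℕ} (w : Fin n → F) (c : F) : ℤ := #{x : Fin n → F | ∑ i, w i * x i ^ 2 = c}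

theorem diagCount_succ {n : ℕ} (w : Fin (n + 1) → F) (c : F) :
    diagCount w c = ∑ x, diagCount (Fin.tail w) (c - w 0 * x ^ 2) := by
  simp only [diagCount]
  rw [Finset.card_eq_sum_card_fiberwise (f := fun x => x 0) (t := univ) (by simp)]
  push_cast
  refine sum_congr rfl fun a _ => ?_
  congr 1
  refine Finset.card_bij' (fun x _ => Fin.tail x) (fun x _ => Fin.cons a x) ?_ ?_ ?_ ?_
  · intro x hx
    simp only [mem_filter, mem_univ, true_and, Fin.sum_univ_succ] at hx ⊢
    rw [eq_sub_iff_add_eq, add_comm, ← hx.1, hx.2]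
    rfl
  · intro x hx
    have hx := (mem_filter.1 hx).2
    simp only [Fin.tail] at hx
    simp only [mem_filter, mem_univ, true_and, Fin.sum_univ_succ, Fin.cons_zero, Fin.cons_succ,
      and_true]
    rw [hx]; ring
  · intro x hx
    simp only [mem_filter, mem_univ, true_and] at hx
    rw [← hx.2, Fin.cons_self_tail]
  · intro x hx
    simp

/-- Peeling off one variable turns the odd formula into the even one and the even into the next odd
one, so the two are proved together. The sign `s` is left unspecified: later counts need only `s ^ 2
= 1` or the case `c = 0`. -/
theorem diagCount_even_odd (hF : ringChar F ≠ 2) (k : ℕ) :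
    (∀ w : Fin (2 * k + 1) → F, (∀ i, w i ≠ 0) → ∃ s : ℤ, (s = 1 ∨ s = -1) ∧ ∀ c,
      diagCount w c = (Fintype.card F : ℤ) ^ (2 * k) + s * (Fintype.card F : ℤ) ^ k *
        quadraticChar F c) ∧
    (∀ w : Fin (2 * k + 2) → F, (∀ i, w i ≠ 0) → ∃ s : ℤ, (s = 1 ∨ s = -1) ∧ ∀ c,
      diagCount w c = (Fintype.card F : ℤ) ^ (2 * k + 1) + s * (Fintype.card F : ℤ) ^ k *
        (if c = 0 then (Fintype.card F : ℤ) - 1 else -1)) := by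
  have step : ∀ k, (∀ w : Fin (2 * k + 1) → F, (∀ i, w i ≠ 0) → ∃ s : ℤ, (s = 1 ∨ s = -1) ∧ ∀ c,
      diagCount w c = (Fintype.card F : ℤ) ^ (2 * k) + s * (Fintype.card F : ℤ) ^ k *
        quadraticChar F c) →
    (∀ w : Fin (2 * k + 2) → F, (∀ i, w i ≠ 0) → ∃ s : ℤ, (s = 1 ∨ s = -1) ∧ ∀ c,
      diagCount w c = (Fintype.card F : ℤ) ^ (2 * k + 1) + s * (Fintype.card F : ℤ) ^ k *
        (if c = 0 then (Fintype.card F : ℤ) - 1 else -1)) := by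
    intro k h w hw
    obtain ⟨s, hs, h⟩ := h (Fin.tail w) fun i => hw _
    refine ⟨s * quadraticChar F (-w 0), ?_, fun c => ?_⟩
    · rcases quadraticChar_dichotomy (neg_ne_zero.2 (hw 0)) with h1 | h1 <;>
        rcases hs with rfl | rfl <;> rw [h1] <;> simp
    · rw [diagCount_succ]
      simp only [h, sum_add_distrib, ← mul_sum]
      rw [sum_quadraticChar_sub_mul_sq hF (hw 0)]
      simp only [sum_const, card_univ, nsmul_eq_mul]
      ring
  induction k with
  | zero =>
    have h0 : ∀ w : Fin (2 * 0 + 1) → F, (∀ i, w i ≠ 0) → ∃ s : ℤ, (s = 1 ∨ s = -1) ∧ ∀ c,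
      diagCount w c = (Fintype.card F : ℤ) ^ (2 * 0) + s * (Fintype.card F : ℤ) ^ 0 *
        quadraticChar F c := by
      intro w hw
      refine ⟨quadraticChar F (w 0), quadraticChar_dichotomy (hw 0), fun c => ?_⟩
      have h1 : ((Fintype.card F : ℤ) ^ (2 * 0) + quadraticChar F (w 0) * (Fintype.card F : ℤ) ^ 0 *
          quadraticChar F c) = #{x : F | w 0 * x ^ 2 = c} := by
        rw [card_mul_sq_eq hF (hw 0)]; simp
      rw [h1, diagCount]
      congr 1
      refine Finset.card_bij' (fun x _ => x 0) (fun x _ _ => x) ?_ ?_ ?_ ?_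
      · intro x; simp
      · intro x; simp
      · intro x _; ext i; exact congrArg x (Subsingleton.elim (α := Fin 1) 0 i)
      · simp
    exact ⟨h0, step 0 h0⟩
  | succ k ih =>
    have h0 : ∀ w : Fin (2 * (k + 1) + 1) → F, (∀ i, w i ≠ 0) → ∃ s : ℤ, (s = 1 ∨ s = -1) ∧ ∀ c,
      diagCount w c = (Fintype.card F : ℤ) ^ (2 * (k + 1)) + s * (Fintype.card F : ℤ) ^ (k + 1) *
        quadraticChar F c := by
      intro w hw
      obtain ⟨s, hs, h⟩ := ih.2 (Fin.tail w) fun i => hw _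
      refine ⟨s * quadraticChar F (w 0), ?_, fun c => ?_⟩
      · rcases quadraticChar_dichotomy (hw 0) with h1 | h1 <;>
          rcases hs with rfl | rfl <;> rw [h1] <;> simp
      · have h1 : ∀ x : F, (if c - w 0 * x ^ 2 = 0 then (Fintype.card F : ℤ) - 1 else -1) =
            Fintype.card F * (if w 0 * x ^ 2 = c then 1 else 0) - 1 := by
          intro x
          simp only [sub_eq_zero, @eq_comm _ c]
          split_ifs <;> ring
        rw [diagCount_succ]
        simp only [h, sum_add_distrib, ← mul_sum, h1, sum_sub_distrib]
        rw [Finset.sum_boole, card_mul_sq_eq hF (hw 0)]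
        simp only [sum_const, card_univ, nsmul_eq_mul]
        ring
    exact ⟨h0, step _ h0⟩

/-- A nondegenerate form in odd characteristic is equivalent to a diagonal one with nonzero weights.
-/
theorem card_quadraticForm_eq (hF : ringChar F ≠ 2) {n k : ℕ} (hn : n = 2 * k + 1)
    (Q : QuadraticForm F (Fin n → F)) (hQ : Q.polarBilin.Nondegenerate) :
    ∃ s : ℤ, (s = 1 ∨ s = -1) ∧ ∀ c, (#{x | Q x = c} : ℤ) =
      (Fintype.card F : ℤ) ^ (2 * k) + s * (Fintype.card F : ℤ) ^ k * quadraticChar F c := by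
  have h2 : (2 : F) ≠ 0 := Ring.two_ne_zero hF
  let : Invertible (2 : F) := invertibleOfNonzero h2
  have hs : (QuadraticMap.associated (R := F) Q).SeparatingLeft := by
    intro x hx
    refine hQ.1 x fun y => ?_
    rw [← QuadraticMap.two_nsmul_associated F Q, LinearMap.smul_apply, LinearMap.smul_apply, hx y,
      smul_zero]
  obtain ⟨w, ⟨e⟩⟩ := Q.equivalent_weightedSumSquares_units_of_nondegenerate' hs
  have hd : Module.finrank F (Fin n → F) = 2 * k + 1 := by simp [hn]
  revert w
  rw [hd]
  intro w e
  obtain ⟨s, hs, h⟩ := (diagCount_even_odd hF k).1 (fun i => (w i : F)) fun i => (w i).ne_zero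
  refine ⟨s, hs, fun c => ?_⟩
  rw [← h, diagCount]
  congr 1
  refine Finset.card_equiv e.toEquiv fun x => ?_
  simp only [mem_filter, mem_univ, true_and]
  rw [← e.map_app x, QuadraticMap.weightedSumSquares_apply]
  simp only [Units.smul_def, smul_eq_mul, ← sq]
  rfl

end Counting

/-! ### Witt's theorem by reflections. -/

section Witt

open QuadraticMap

variable {F V : Type*} [Field F] [AddCommGroup V] [Module F V] {Q : QuadraticForm F V}

theorem apply_add_smul (Q : QuadraticForm F V) (x y : V) (a b : F) :
    Q (a • x + b • y) = a ^ 2 * Q x + a * b * polar Q x y + b ^ 2 * Q y := by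
  rw [QuadraticMap.map_add Q, QuadraticMap.map_smul, QuadraticMap.map_smul, polar_smul_left,
    polar_smul_right]
  simp only [smul_eq_mul]
  ring

theorem apply_sub (Q : QuadraticForm F V) (x y : V) :
    Q (x - y) = Q x + Q y - polar Q x y := by
  have := apply_add_smul Q x y 1 (-1)
  rw [one_smul, neg_one_smul, ← sub_eq_add_neg] at this
  rw [this]; ring

/-- The reflection in the hyperplane orthogonal to a nonsingular vector. -/
theorem exists_reflection {x : V} (hx : Q x ≠ 0) :
    ∃ g : Q.IsometryEquiv Q, ∀ y, g y = y - (polar Q x y / Q x) • x := by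
  let f : Module.Dual F V := (Q x)⁻¹ • Q.polarBilin x
  have hf : f x = 2 := by
    simp only [f, LinearMap.smul_apply, polarBilin_apply_apply, polar_self, smul_eq_mul, nsmul_eq_mul]
    push_cast
    field_simp
  have hr : ∀ y, Module.reflection hf y = y - (polar Q x y / Q x) • x := by
    intro y
    rw [Module.reflection_apply]
    simp [f, div_eq_inv_mul]
  refine ⟨⟨Module.reflection hf, fun y => ?_⟩, hr⟩
  change Q (Module.reflection hf y) = Q y
  rw [hr]
  have := apply_add_smul Q y x 1 (-(polar Q x y / Q x))
  rw [one_smul, neg_smul, ← sub_eq_add_neg] at this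
  rw [this, polar_comm _ y x]
  field_simp
  ring

/-- Since `Q (x + y) + Q (x - y) = 4 * Q x ≠ 0`, one of `x - y`, `x + y` is nonsingular. The
reflection in `x - y` sends `x` to `y`; the one in `x + y` sends `x` to `-y`, and the reflection in
`y` repairs the sign. All mirrors are orthogonal to vectors in the span of `x` and `y`, hence the
fixed vectors, which drive the induction on orthogonal families. -/
theorem exists_isometryEquiv_single (h2 : (2 : F) ≠ 0) {x y : V} (hx : Q x ≠ 0) (h : Q x = Q y) :
    ∃ g : Q.IsometryEquiv Q, g x = y ∧ ∀ z, polar Q x z = 0 → polar Q y z = 0 → g z = z := by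
  have hQ := apply_sub Q x y
  by_cases h0 : Q (x - y) = 0
  · have h1 : Q (x + y) ≠ 0 := by
      intro h1
      rw [QuadraticMap.map_add Q] at h1
      have : 2 * 2 * Q x = 0 := by linear_combination h1 - hQ + h0 + 2 * h
      exact mul_ne_zero (mul_ne_zero h2 h2) hx this
    obtain ⟨g, hg⟩ := exists_reflection h1
    obtain ⟨g', hg'⟩ := exists_reflection (h ▸ hx : Q y ≠ 0)
    have e : g x = -y := by
      have : polar Q (x + y) x = Q (x + y) := by
        rw [polar_add_left, polar_self, QuadraticMap.map_add Q, polar_comm Q y x, two_nsmul, ← h]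
      rw [hg, this, div_self h1, one_smul]; abel
    refine ⟨g.trans g', ?_, fun z h3 h4 => ?_⟩
    · change g' (g x) = y
      rw [e, hg', polar_neg_right, polar_self, neg_div, two_nsmul, ← two_mul,
        mul_div_cancel_right₀ _ (h ▸ hx : Q y ≠ 0)]
      module
    · change g' (g z) = z
      rw [hg, polar_add_left, h3, h4, add_zero, zero_div, zero_smul, sub_zero, hg', h4, zero_div,
        zero_smul, sub_zero]
  · obtain ⟨g, hg⟩ := exists_reflection h0
    refine ⟨g, ?_, fun z h3 h4 => ?_⟩
    · have : polar Q (x - y) x = Q (x - y) := by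
        rw [polar_sub_left, polar_self, hQ, polar_comm Q y x, two_nsmul, ← h]
      rw [hg, this, div_self h0, one_smul, sub_sub_cancel]
    · rw [hg, polar_sub_left, h3, h4, sub_zero, zero_div, zero_smul, sub_zero]

theorem polar_isometryEquiv (g : Q.IsometryEquiv Q) (x y : V) :
    polar Q (g x) (g y) = polar Q x y := by
  simp only [polar, ← map_add, g.map_app]

/-- Witt's theorem for orthogonal families of nonsingular vectors. -/
theorem exists_isometryEquiv_orthogonal (h2 : (2 : F) ≠ 0) {k : ℕ} (a b : Fin k → V)
    (ha : ∀ i, Q (a i) ≠ 0) (hab : ∀ i, Q (a i) = Q (b i))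
    (ha' : ∀ i j, i < j → polar Q (a i) (a j) = 0)
    (hb' : ∀ i j, i < j → polar Q (b i) (b j) = 0) :
    ∃ g : Q.IsometryEquiv Q, ∀ i, g (a i) = b i := by
  induction k with
  | zero => exact ⟨.refl Q, fun i => i.elim0⟩
  | succ k ih =>
    obtain ⟨g, hg⟩ := ih (fun i => a i.castSucc) (fun i => b i.castSucc) (fun i => ha _)
      (fun i => hab _) (fun i j h => ha' _ _ (Fin.castSucc_lt_castSucc_iff.2 h))
      (fun i j h => hb' _ _ (Fin.castSucc_lt_castSucc_iff.2 h))
    obtain ⟨g', h1, h3⟩ := exists_isometryEquiv_single h2 (Q := Q) (x := g (a (Fin.last k)))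
      (y := b (Fin.last k)) (by rw [g.map_app]; exact ha _) (by rw [g.map_app]; exact hab _)
    refine ⟨g.trans g', fun i => ?_⟩
    change g' (g (a i)) = b i
    induction i using Fin.lastCases with
    | last => exact h1
    | cast i =>
      -- The correcting isometry `g'` fixes the vectors already placed, as these are orthogonal both
      -- to the current image of the last vector and to its target.
      rw [hg, h3]
      · rw [← hg, polar_isometryEquiv, polar_comm]
        exact ha' _ _ (Fin.castSucc_lt_last i)
      · rw [polar_comm]
        exact hb' _ _ (Fin.castSucc_lt_last i)

theorem eq_of_add_eq_of_sub_eq (h2 : (2 : F) ≠ 0) {a b c d : V} (h : a + b = c + d)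
    (h' : a - b = c - d) : a = c ∧ b = d := by
  have e : a = c := by
    apply smul_right_injective V h2
    change (2 : F) • a = (2 : F) • c
    rw [two_smul, two_smul]
    calc a + a = (a + b) + (a - b) := by abel
      _ = c + c := by rw [h, h']; abel
  subst e
  exact ⟨rfl, add_left_cancel h⟩

/-- Witt's theorem for pairs spanning a nondegenerate plane. -/
theorem exists_isometryEquiv_pair (h2 : (2 : F) ≠ 0) {u v u' v' : V} (hu : Q u = Q u')
    (hv : Q v = Q v') (huv : polar Q u v = polar Q u' v')
    (hd : polar Q u v ^ 2 - 4 * Q u * Q v ≠ 0) (h0 : Q v = 0 → Q u = 0) :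
    ∃ g : Q.IsometryEquiv Q, g u = u' ∧ g v = v' := by
  -- By `h0` either both vectors are singular, or `v` is nonsingular and can start a Gram–Schmidt
  -- step. In the first case `u + v` and `u - v` are orthogonal, with values `± polar Q u v ≠ 0`.
  by_cases hv0 : Q v = 0
  · have hu0 := h0 hv0
    have hm : polar Q u v ≠ 0 := by
      intro hm; apply hd; rw [hm, hu0]; ring
    have e1 : ∀ x y : V, polar Q (x + y) (x - y) = 2 * Q x - 2 * Q y := by
      intro x y
      rw [polar_add_left, polar_sub_right, polar_sub_right, polar_self, polar_self,
        polar_comm Q y x, two_nsmul, two_nsmul]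
      ring
    obtain ⟨g, hg⟩ := exists_isometryEquiv_orthogonal h2 (Q := Q) ![u + v, u - v]
      ![u' + v', u' - v'] (by
        intro i
        fin_cases i
        · simpa [QuadraticMap.map_add Q, hv0, hu0] using hm
        · simpa [apply_sub, hv0, hu0] using hm) (by
        intro i
        fin_cases i
        · simp [QuadraticMap.map_add Q, hu, hv, huv]
        · simp [apply_sub, hu, hv, huv]) (by
        intro i j hij
        fin_cases i <;> fin_cases j <;> simp at hij
        simp [e1, hu0, hv0]) (by
        intro i j hij
        fin_cases i <;> fin_cases j <;> simp at hij
        simp [e1, ← hu, ← hv, hu0, hv0])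
    have g0 : g (u + v) = u' + v' := hg 0
    have g1 : g (u - v) = u' - v' := hg 1
    rw [map_add] at g0
    rw [map_sub] at g1
    exact ⟨g, eq_of_add_eq_of_sub_eq h2 g0 g1⟩
  -- `t` is the Gram–Schmidt coefficient making `u - t • v` orthogonal to `v`; nonvanishing of the
  -- discriminant makes that vector nonsingular.
  · obtain ⟨t, ht'⟩ : ∃ t, t * (2 * Q v) = polar Q u v :=
      ⟨_, div_mul_cancel₀ _ (mul_ne_zero h2 hv0)⟩
    have e1 : ∀ x y : V, Q (x - t • y) = Q x - t * polar Q x y + t ^ 2 * Q y := by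
      intro x y
      rw [apply_sub, QuadraticMap.map_smul, polar_smul_right, smul_eq_mul, smul_eq_mul]; ring
    have e2 : ∀ x y : V, polar Q y (x - t • y) = polar Q x y - t * (2 * Q y) := by
      intro x y
      rw [polar_sub_right, polar_smul_right, polar_self, polar_comm, two_nsmul, smul_eq_mul]; ring
    obtain ⟨g, hg⟩ := exists_isometryEquiv_orthogonal h2 (Q := Q) ![v, u - t • v]
      ![v', u' - t • v'] (by
        intro i
        fin_cases i
        · exact hv0
        · change Q (u - t • v) ≠ 0
          rw [e1]
          intro h
          apply hd
          linear_combination (-4 * Q v) * h + (t * (2 * Q v) - polar Q u v) * ht') (by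
        intro i
        fin_cases i
        · exact hv
        · change Q (u - t • v) = Q (u' - t • v')
          rw [e1, e1, hu, hv, huv]) (by
        intro i j hij
        fin_cases i <;> fin_cases j <;> simp at hij
        change polar Q v (u - t • v) = 0
        rw [e2, ht', sub_self]) (by
        intro i j hij
        fin_cases i <;> fin_cases j <;> simp at hij
        change polar Q v' (u' - t • v') = 0
        rw [e2, ← hv, ht', huv, sub_self])
    have g0 : g v = v' := hg 0
    have g1 : g (u - t • v) = u' - t • v' := hg 1
    rw [map_sub, map_smul, g0, sub_left_inj] at g1
    exact ⟨g, g1, g0⟩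

variable [FiniteDimensional F V]

/-- The prescribed values extend to a linear functional, which nondegeneracy represents by a vector.
-/
theorem exists_polar_eq (hQ : Q.polarBilin.Nondegenerate) {k : ℕ} {x : Fin k → V}
    (hx : LinearIndependent F x) (c : Fin k → F) : ∃ y, ∀ i, polar Q (x i) y = c i := by
  obtain ⟨f, hf⟩ := LinearMap.exists_extend
    ((Finsupp.linearCombination F c) ∘ₗ hx.repr)
  refine ⟨(LinearMap.BilinForm.toDual Q.polarBilin hQ).symm f, fun i => ?_⟩
  have h1 := LinearMap.BilinForm.apply_toDual_symm_apply (hB := hQ) f (x i)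
  rw [polarBilin_apply_apply] at h1
  rw [polar_comm, h1]
  have h3 := LinearMap.congr_fun hf ⟨x i, Submodule.subset_span ⟨i, rfl⟩⟩
  simpa [hx.repr_eq_single i] using h3

/-- Witt's theorem for singular vectors. -/
theorem exists_isometryEquiv_singular (h2 : (2 : F) ≠ 0) (hQ : Q.polarBilin.Nondegenerate)
    {u u' : V} (hu : u ≠ 0) (hu' : u' ≠ 0) (hq : Q u = 0) (hq' : Q u' = 0) :
    ∃ g : Q.IsometryEquiv Q, g u = u' := by
  -- Complete `u` to a hyperbolic pair: subtracting `Q y • u` from any `y` with `polar Q u y = 1`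
  -- kills its value without changing the pairing.
  have key : ∀ u : V, u ≠ 0 → Q u = 0 → ∃ w, Q w = 0 ∧ polar Q u w = 1 := by
    intro u hu hq
    obtain ⟨y, hy⟩ := exists_polar_eq hQ (x := fun _ : Fin 1 => u)
      (LinearIndependent.of_subsingleton 0 hu) 1
    have hy : polar Q u y = 1 := hy 0
    refine ⟨y - Q y • u, ?_, ?_⟩
    · rw [apply_sub, QuadraticMap.map_smul, polar_smul_right, hq, polar_comm, hy]; simp
    · rw [polar_sub_right, polar_smul_right, polar_self, hq, hy]; simp
  obtain ⟨w, hw, huw⟩ := key u hu hq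
  obtain ⟨w', hw', huw'⟩ := key u' hu' hq'
  obtain ⟨g, hg, -⟩ := exists_isometryEquiv_pair h2 (Q := Q) (hq.trans hq'.symm)
    (hw.trans hw'.symm) (huw.trans huw'.symm) (by rw [huw, hq]; simp) (fun _ => hq)
  exact ⟨g, hg⟩

/-- Witt's theorem for totally singular planes. -/
theorem exists_isometryEquiv_totallySingular (h2 : (2 : F) ≠ 0) (hQ : Q.polarBilin.Nondegenerate)
    {u v u' v' : V} (hi : LinearIndependent F ![u, v]) (hi' : LinearIndependent F ![u', v'])
    (hu : Q u = 0) (hv : Q v = 0) (huv : polar Q u v = 0)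
    (hu' : Q u' = 0) (hv' : Q v' = 0) (huv' : polar Q u' v' = 0) :
    ∃ g : Q.IsometryEquiv Q, g u = u' ∧ g v = v' := by
  -- Complete `u, v` to two mutually orthogonal hyperbolic pairs `(u, w)` and `(v, z)`. Sums and
  -- differences within each pair are then four orthogonal vectors with values `1, -1, 1, -1`, to
  -- which the orthogonal case applies.
  have key : ∀ u v : V, LinearIndependent F ![u, v] → Q u = 0 → Q v = 0 → polar Q u v = 0 →
      ∃ w z, Q w = 0 ∧ Q z = 0 ∧ polar Q u w = 1 ∧ polar Q v w = 0 ∧ polar Q u z = 0 ∧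
        polar Q v z = 1 ∧ polar Q w z = 0 := by
    intro u v hi hu hv huv
    obtain ⟨y, hy⟩ := exists_polar_eq hQ hi ![1, 0]
    obtain ⟨z, hz⟩ := exists_polar_eq hQ hi ![0, 1]
    have hy0 : polar Q u y = 1 := hy 0
    have hy1 : polar Q v y = 0 := hy 1
    have hz0 : polar Q u z = 0 := hz 0
    have hz1 : polar Q v z = 1 := hz 1
    have huu : polar Q u u = 0 := by rw [polar_self, hu, smul_zero]
    have hvv : polar Q v v = 0 := by rw [polar_self, hv, smul_zero]
    have hvu : polar Q v u = 0 := by rw [polar_comm, huv]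
    set w := y - Q y • u with hw
    have w0 : Q w = 0 := by
      rw [apply_sub, QuadraticMap.map_smul, polar_smul_right, hu, polar_comm, hy0]; simp
    have uw : polar Q u w = 1 := by
      rw [polar_sub_right, polar_smul_right, huu, hy0]; simp
    have vw : polar Q v w = 0 := by
      rw [polar_sub_right, polar_smul_right, hvu, hy1]; simp
    set z' := z - polar Q w z • u with hz'
    have uz : polar Q u z' = 0 := by
      rw [polar_sub_right, polar_smul_right, huu, hz0]; simp
    have vz : polar Q v z' = 1 := by
      rw [polar_sub_right, polar_smul_right, hvu, hz1]; simp
    have wz : polar Q w z' = 0 := by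
      rw [polar_sub_right, polar_smul_right, polar_comm Q w u, uw]; simp
    refine ⟨w, z' - Q z' • v, w0, ?_, uw, vw, ?_, ?_, ?_⟩
    · rw [apply_sub, QuadraticMap.map_smul, polar_smul_right, hv, polar_comm, vz]; simp
    · rw [polar_sub_right, polar_smul_right, huv, uz]; simp
    · rw [polar_sub_right, polar_smul_right, hvv, vz]; simp
    · rw [polar_sub_right, polar_smul_right, polar_comm Q w v, vw, wz]; simp
  obtain ⟨w, z, w0, z0, uw, vw, uz, vz, wz⟩ := key u v hi hu hv huv
  obtain ⟨w', z', w0', z0', uw', vw', uz', vz', wz'⟩ := key u' v' hi' hu' hv' huv'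
  have orth : ∀ u v w z : V, Q u = 0 → Q v = 0 → polar Q u v = 0 → Q w = 0 → Q z = 0 →
      polar Q v w = 0 → polar Q u z = 0 → polar Q w z = 0 →
      ∀ i j : Fin 4, i < j → polar Q (![u + w, u - w, v + z, v - z] i)
        (![u + w, u - w, v + z, v - z] j) = 0 := by
    intro u v w z hu hv huv w0 z0 vw uz wz i j hij
    fin_cases i <;> fin_cases j <;> simp at hij <;>
      simp [polar_add_left, polar_add_right, polar_sub_left, polar_sub_right, polar_self, hu, hv,
        huv, w0, z0, uz, wz, polar_comm Q w v, polar_comm Q w u,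
        polar_comm Q z v, vw]
  obtain ⟨g, hg⟩ := exists_isometryEquiv_orthogonal h2 (Q := Q) ![u + w, u - w, v + z, v - z]
    ![u' + w', u' - w', v' + z', v' - z'] (by
      intro i
      fin_cases i <;> simp [QuadraticMap.map_add Q, apply_sub, hu, hv, w0, z0, uw, vz]) (by
      intro i
      fin_cases i <;> simp [QuadraticMap.map_add Q, apply_sub, hu, hv, w0, z0, uw, vz, hu', hv',
        w0', z0', uw', vz']) (orth u v w z hu hv huv w0 z0 vw uz wz)
      (orth u' v' w' z' hu' hv' huv' w0' z0' vw' uz' wz')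
  have g0 : g (u + w) = u' + w' := hg 0
  have g1 : g (u - w) = u' - w' := hg 1
  have g2 : g (v + z) = v' + z' := hg 2
  have g3 : g (v - z) = v' - z' := hg 3
  rw [map_add] at g0 g2
  rw [map_sub] at g1 g3
  exact ⟨g, (eq_of_add_eq_of_sub_eq h2 g0 g1).1, (eq_of_add_eq_of_sub_eq h2 g2 g3).1⟩

end Witt

/-! ### The quadratic extension and the splitting `x = u + e v`. -/

section QuadraticExtension

open QuadraticMap (polar polar_self polar_comm polarBilin_apply_apply)

variable {F K : Type*} [Field F] [Field K] [Algebra F K]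

/-- `e` generates the quadratic extension `K` of the finite field `F` of odd order, and `e ^ 2 = d`
is a nonsquare of `F`. -/
structure IsQuadGen (d : F) (e : K) : Prop where
  two_ne_zero : (2 : F) ≠ 0
  not_isSquare : ¬IsSquare d
  sq_eq : e ^ 2 = algebraMap F K d
  pow_card : e ^ Nat.card F = -e
  card_eq : Nat.card K = Nat.card F ^ 2
  exists_eq : ∀ z : K, ∃ a b : F, z = algebraMap F K a + e * algebraMap F K b

theorem coe_add_mul_eq_zero {d : F} {e : K} (he : e ^ 2 = algebraMap F K d) (hd : ¬IsSquare d)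
    {a b : F} (h : algebraMap F K a + e * algebraMap F K b = 0) : a = 0 ∧ b = 0 := by
  have hb : b = 0 := by
    by_contra hb
    apply hd
    refine ⟨a / b, (algebraMap F K).injective ?_⟩
    have hb' : algebraMap F K b ≠ 0 := by simpa using hb
    rw [← he, map_mul, map_div₀]
    field_simp
    linear_combination (-algebraMap F K a + e * algebraMap F K b) * h
  subst hb
  simpa using h

theorem ringChar_ne_two_of_odd [Finite F] (hq : Odd (Nat.card F)) : ringChar F ≠ 2 := by
  intro h
  have := Fintype.ofFinite F
  rw [Nat.card_eq_fintype_card, ← Nat.not_even_iff_odd] at hq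
  exact hq (Nat.even_iff.2 (FiniteField.even_card_iff_char_two.1 h))

/-- With `q = 2 * m + 1`, Euler's criterion gives `d ^ m = -1` for a nonsquare `d`. As `(q ^ 2 - 1)
/ 2 = m * (2 * (m + 1))`, the same criterion in `K` makes `d` a square there, and its root satisfies
`e ^ q = d ^ m * e = -e`. An injection between sets of size `q ^ 2` shows that `1, e` span. -/
theorem exists_isQuadGen [Finite F] [Finite K] (hK : Nat.card K = Nat.card F ^ 2)
    (hq : Odd (Nat.card F)) : ∃ (d : F) (e : K), IsQuadGen d e := by
  have := Fintype.ofFinite F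
  have := Fintype.ofFinite K
  have hF := ringChar_ne_two_of_odd hq
  have hF' : ringChar K ≠ 2 := ringChar_ne_two_of_odd (by rw [hK]; exact hq.pow)
  obtain ⟨m, hm⟩ := hq
  obtain ⟨d, hd⟩ := FiniteField.exists_nonsquare hF
  have hd0 : d ≠ 0 := by rintro rfl; exact hd (.zero)
  have hc : Fintype.card F = 2 * m + 1 := by rw [← Nat.card_eq_fintype_card, hm]
  have hcK : Fintype.card K = (2 * m + 1) ^ 2 := by rw [← Nat.card_eq_fintype_card, hK, hm]
  have hhalf : d ^ m = -1 := by
    have h1 := FiniteField.pow_dichotomy hF hd0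
    have h2 : Fintype.card F / 2 = m := by omega
    rw [h2] at h1
    refine h1.resolve_left fun h => hd ((FiniteField.isSquare_iff hF hd0).2 ?_)
    rw [h2, h]
  obtain ⟨e, he⟩ : IsSquare (algebraMap F K d) := by
    rw [FiniteField.isSquare_iff hF' (by simpa using hd0)]
    have h2 : Fintype.card K / 2 = m * (2 * (m + 1)) := by
      rw [hcK]
      have : (2 * m + 1) ^ 2 = 2 * (m * (2 * (m + 1))) + 1 := by ring
      omega
    rw [h2, pow_mul, ← map_pow, hhalf, pow_mul]
    simp
  rw [← sq] at he
  refine ⟨d, e, Ring.two_ne_zero hF, hd, he.symm, ?_, hK, ?_⟩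
  · rw [hm, pow_succ, pow_mul, ← he, ← map_pow, hhalf]
    simp
  · let f : F × F → K := fun p => algebraMap F K p.1 + e * algebraMap F K p.2
    have hf : Function.Injective f := by
      intro p p' h
      have := coe_add_mul_eq_zero he.symm hd (a := p.1 - p'.1) (b := p.2 - p'.2) (by
        simp only [f] at h
        rw [map_sub, map_sub]
        linear_combination h)
      exact Prod.ext (sub_eq_zero.1 this.1) (sub_eq_zero.1 this.2)
    have hb := (Fintype.bijective_iff_injective_and_card f).2 ⟨hf, by
      rw [Fintype.card_prod, hcK, hc, sq]⟩
    intro z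
    obtain ⟨p, hp⟩ := hb.2 z
    exact ⟨p.1, p.2, hp.symm⟩

namespace IsQuadGen

variable {d : F} {e : K}

theorem pow_card_eq [Finite F] (h : IsQuadGen d e) (a b : F) :
    (algebraMap F K a + e * algebraMap F K b) ^ Nat.card F =
      algebraMap F K a - e * algebraMap F K b := by
  have := Fintype.ofFinite F
  have h1 := map_add (FiniteField.frobeniusAlgHom F K) (algebraMap F K a) (e * algebraMap F K b)
  have h2 := h.pow_card
  rw [Nat.card_eq_fintype_card] at h2 ⊢
  simp only [FiniteField.coe_frobeniusAlgHom, mul_pow, h2, ← map_pow, FiniteField.pow_card] at h1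
  rw [h1]; ring

/-- An element is a square iff its norm is: `a ^ 2 - d * b ^ 2` is the power `q + 1` of `a + e b`,
and `(q ^ 2 - 1) / 2 = (q + 1) * ((q - 1) / 2)` matches the two Euler criteria. -/
theorem isSquare_iff [Finite F] [Finite K] (h : IsQuadGen d e) {a b : F}
    (h0 : algebraMap F K a + e * algebraMap F K b ≠ 0) :
    IsSquare (algebraMap F K a + e * algebraMap F K b) ↔ IsSquare (a ^ 2 - d * b ^ 2) := by
  have := Fintype.ofFinite F
  have := Fintype.ofFinite K
  have hF : ringChar F ≠ 2 := by
    intro hc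
    have := ringChar.Nat.cast_ringChar (R := F)
    rw [hc] at this
    exact h.two_ne_zero (by simpa using this)
  have hF' : ringChar K ≠ 2 := by
    intro hc
    have h1 := ringChar.Nat.cast_ringChar (R := K)
    rw [hc] at h1
    refine h.two_ne_zero ((algebraMap F K).injective ?_)
    rw [map_zero, ← h1, map_ofNat]; simp
  have hn : algebraMap F K (a ^ 2 - d * b ^ 2) =
      (algebraMap F K a + e * algebraMap F K b) ^ (Nat.card F + 1) := by
    rw [pow_succ _ (Nat.card F), h.pow_card_eq]
    simp only [map_sub, map_mul, map_pow, ← h.sq_eq]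
    ring
  have hn0 : a ^ 2 - d * b ^ 2 ≠ 0 := by
    intro h1
    rw [h1, map_zero] at hn
    exact pow_ne_zero _ h0 hn.symm
  have hodd : Fintype.card F % 2 = 1 := FiniteField.odd_card_of_char_ne_two hF
  rw [FiniteField.isSquare_iff hF hn0, FiniteField.isSquare_iff hF' h0]
  have hc : Fintype.card K / 2 = (Nat.card F + 1) * (Fintype.card F / 2) := by
    have := h.card_eq
    rw [Nat.card_eq_fintype_card, Nat.card_eq_fintype_card] at this
    rw [this, Nat.card_eq_fintype_card]
    obtain ⟨m, hm⟩ : ∃ m, Fintype.card F = 2 * m + 1 := ⟨Fintype.card F / 2, by omega⟩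
    have h2 : Fintype.card F / 2 = m := by omega
    rw [h2, hm]
    have : (2 * m + 1) ^ 2 = 2 * ((2 * m + 1 + 1) * m) + 1 := by ring
    omega
  rw [hc, pow_mul, ← hn, ← map_pow]
  constructor
  · intro h1
    apply (algebraMap F K).injective
    rw [h1, map_one]
  · intro h1
    rw [h1, map_one]

end IsQuadGen

variable {n : ℕ}

/-- The vector `u + e v` of `K ^ n`. -/
def comb (e : K) (u v : Fin n → F) : Fin n → K := incl K u + e • incl K v

theorem polarExt_incl (Q : QuadraticForm F (Fin n → F)) (u v : Fin n → F) :
    polarExt K Q (incl K u) (incl K v) = algebraMap F K (polar Q u v) := by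
  have h : polar Q u v = Matrix.toBilin' (LinearMap.BilinForm.toMatrix' Q.polarBilin) u v := by
    rw [Matrix.toBilin'_toMatrix', polarBilin_apply_apply]
  rw [h, polarExt, Matrix.toBilin'_apply, Matrix.toBilin'_apply]
  simp [incl]

theorem polarExt_comb (Q : QuadraticForm F (Fin n → F)) (e f : K) (u v u' v' : Fin n → F) :
    polarExt K Q (comb e u v) (comb f u' v') = algebraMap F K (polar Q u u') +
      f * algebraMap F K (polar Q u v') + e * algebraMap F K (polar Q v u') +
      e * f * algebraMap F K (polar Q v v') := by
  simp only [comb, map_add, map_smul, LinearMap.add_apply, LinearMap.smul_apply, polarExt_incl,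
    smul_eq_mul]
  ring

variable {d : F} {e : K}

/-- When `Q u = d * Q v`, this single element of `K` determines the Gram matrix of `u, v`. -/
theorem IsQuadGen.polarExt_self (h : IsQuadGen d e) (Q : QuadraticForm F (Fin n → F))
    (u v : Fin n → F) : polarExt K Q (comb e u v) (comb e u v) =
      algebraMap F K (2 * (Q u + d * Q v)) + e * algebraMap F K (2 * polar Q u v) := by
  rw [polarExt_comb, polar_self, polar_self, polar_comm Q v u]
  simp only [nsmul_eq_mul, map_mul, map_add, map_ofNat, Nat.cast_ofNat, ← h.sq_eq]
  ring

theorem IsQuadGen.tau_comb [Finite F] (h : IsQuadGen d e) (u v : Fin n → F) :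
    tau F K (comb e u v) = comb (-e) u v := by
  ext i
  simp only [tau, comb, incl, Pi.add_apply, Pi.smul_apply, LinearMap.coe_mk, AddHom.coe_mk,
    smul_eq_mul]
  rw [h.pow_card_eq]
  ring

theorem IsQuadGen.hermForm_self [Finite F] (h : IsQuadGen d e) (Q : QuadraticForm F (Fin n → F))
    (u v : Fin n → F) : hermForm K Q (comb e u v) (comb e u v) =
      algebraMap F K (2 * (Q u - d * Q v)) := by
  rw [hermForm, h.tau_comb, polarExt_comb, polar_self, polar_self, polar_comm Q v u]
  simp only [nsmul_eq_mul, map_mul, map_sub, map_ofNat, Nat.cast_ofNat, ← h.sq_eq]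
  ring

theorem IsQuadGen.exists_comb (h : IsQuadGen d e) (x : Fin n → K) :
    ∃ u v : Fin n → F, x = comb e u v := by
  choose a b hab using h.exists_eq
  exact ⟨fun i => a (x i), fun i => b (x i), funext fun i => hab (x i)⟩

theorem IsQuadGen.comb_injective (h : IsQuadGen d e) {u v u' v' : Fin n → F}
    (h1 : comb e u v = comb e u' v') : u = u' ∧ v = v' := by
  have key : ∀ i, u i - u' i = 0 ∧ v i - v' i = 0 := fun i =>
    coe_add_mul_eq_zero h.sq_eq h.not_isSquare (by
      have : algebraMap F K (u i) + e * algebraMap F K (v i) =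
        algebraMap F K (u' i) + e * algebraMap F K (v' i) := congrFun h1 i
      rw [map_sub, map_sub]
      linear_combination this)
  exact ⟨funext fun i => sub_eq_zero.1 (key i).1, funext fun i => sub_eq_zero.1 (key i).2⟩

theorem comb_zero : comb e (0 : Fin n → F) 0 = 0 := by
  simp [comb]

theorem IsQuadGen.smul_comb (h : IsQuadGen d e) (a b : F) (u v : Fin n → F) :
    (algebraMap F K a + e * algebraMap F K b) • comb e u v =
      comb e (a • u + (d * b) • v) (b • u + a • v) := by
  ext i
  simp only [comb, incl, Pi.add_apply, Pi.smul_apply, LinearMap.coe_mk, AddHom.coe_mk,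
    smul_eq_mul, map_add, map_mul, ← h.sq_eq]
  ring

theorem mulVec_comb (g : GL (Fin n) F) (u v : Fin n → F) :
    (Matrix.GeneralLinearGroup.map (algebraMap F K) g).1.mulVec (comb e u v) =
      comb e (g.1.mulVec u) (g.1.mulVec v) := by
  have h1 : ∀ w : Fin n → F, (Matrix.GeneralLinearGroup.map (algebraMap F K) g).1.mulVec
      (incl K w) = incl K (g.1.mulVec w) := by
    intro w
    ext i
    exact (RingHom.map_mulVec (algebraMap F K) g.1 w i).symm
  rw [comb, Matrix.mulVec_add, Matrix.mulVec_smul, h1, h1]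
  rfl

end QuadraticExtension

/-! ### The discriminant of `Q` on the plane spanned by two vectors. -/

section Disc

open QuadraticMap (polar polar_self polar_comm polar_smul_left polar_smul_right)

variable {F V : Type*} [Field F] [AddCommGroup V] [Module F V]

/-- The discriminant of a quadratic form on a pair of vectors. -/
def disc (Q : QuadraticForm F V) (u v : V) : F := polar Q u v ^ 2 - 4 * Q u * Q v

theorem exists_smul_of_not_linearIndependent {u v : V} (h : ¬LinearIndependent F ![u, v]) :
    ∃ (w : V) (a b : F), u = a • w ∧ v = b • w := by
  rw [LinearIndependent.pair_iff] at h
  push Not at h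
  obtain ⟨s, t, hst, h⟩ := h
  by_cases hs : s = 0
  · refine ⟨u, 1, 0, (one_smul _ _).symm, ?_⟩
    rw [hs, zero_smul, zero_add] at hst
    rw [zero_smul]
    exact (smul_eq_zero.1 hst).resolve_left (h hs)
  · refine ⟨v, -(t / s), 1, ?_, (one_smul _ _).symm⟩
    apply smul_right_injective V hs
    change s • u = s • _
    rw [smul_smul, mul_neg, mul_div_cancel₀ _ hs, neg_smul]
    exact eq_neg_of_add_eq_zero_left hst

theorem disc_smul_smul (Q : QuadraticForm F V) (w : V) (a b : F) :
    disc Q (a • w) (b • w) = 0 := by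
  simp only [disc, polar_smul_left, polar_smul_right, polar_self, QuadraticMap.map_smul,
    smul_eq_mul, nsmul_eq_mul]
  push_cast
  ring

theorem linearIndependent_of_disc_ne_zero {Q : QuadraticForm F V} {u v : V}
    (h : disc Q u v ≠ 0) : LinearIndependent F ![u, v] := by
  by_contra hi
  obtain ⟨w, a, b, rfl, rfl⟩ := exists_smul_of_not_linearIndependent hi
  exact h (disc_smul_smul Q w a b)

theorem finrank_span_pair {u v : V} (h : LinearIndependent F ![u, v]) :
    Module.finrank F (Submodule.span F {u, v}) = 2 := by
  have := finrank_span_eq_card h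
  rwa [Matrix.range_cons_cons_empty, Fintype.card_fin] at this

theorem eq_span_pair {l : Submodule F V} (hl : Module.finrank F l = 2) {u v : V} (hu : u ∈ l)
    (hv : v ∈ l) (h : LinearIndependent F ![u, v]) : l = Submodule.span F {u, v} := by
  have : FiniteDimensional F l := Module.finite_of_finrank_pos (by omega)
  refine (Submodule.eq_of_le_of_finrank_eq ?_ ?_).symm
  · rw [Submodule.span_le]
    rintro x (rfl | rfl) <;> assumption
  · rw [hl, finrank_span_pair h]

variable {Q : QuadraticForm F V} {u v : V} {d : F}

/-- Here `disc = polar Q u v ^ 2 - 4 * d * Q v ^ 2`, so its vanishing with `Q v ≠ 0` would make `d`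
a square. -/
theorem eq_zero_of_disc_eq_zero (h2 : (2 : F) ≠ 0) (hd : ¬IsSquare d) (huv : Q u = d * Q v)
    (h : disc Q u v = 0) : Q u = 0 ∧ Q v = 0 ∧ polar Q u v = 0 := by
  rw [disc] at h
  have hv : Q v = 0 := by
    by_contra hv
    refine hd ⟨polar Q u v / (2 * Q v), ?_⟩
    field_simp
    linear_combination -h - 4 * Q v * huv
  rw [hv, mul_zero] at huv
  refine ⟨huv, hv, ?_⟩
  rw [huv, hv] at h
  simpa using h

/-- The quadratic formula for `Q (u + t • v) = 0`. The vectors for the two roots have polar value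
`-disc / Q v`, nonzero; if `Q v = 0`, then `u, v` themselves serve. -/
theorem exists_singular_pair (h2 : (2 : F) ≠ 0) (huv : Q u = d * Q v)
    (h : IsSquare (disc Q u v)) (h0 : disc Q u v ≠ 0) :
    ∃ f ∈ Submodule.span F {u, v}, ∃ g ∈ Submodule.span F {u, v}, Q f = 0 ∧ Q g = 0 ∧
      polar Q f g ≠ 0 := by
  by_cases hv : Q v = 0
  · rw [hv, mul_zero] at huv
    refine ⟨u, Submodule.subset_span (by simp), v, Submodule.subset_span (by simp), huv, hv, ?_⟩
    intro hm
    rw [disc, huv, hv, hm] at h0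
    simp at h0
  · obtain ⟨s, hs⟩ := h
    have key : ∀ s, disc Q u v = s * s →
        Q (1 • u + ((-polar Q u v + s) / (2 * Q v)) • v) = 0 := by
      intro s hs
      have := apply_add_smul Q u v 1 ((-polar Q u v + s) / (2 * Q v))
      rw [one_smul] at this ⊢
      rw [this]
      rw [disc] at hs
      field_simp
      linear_combination -hs
    have mem : ∀ t : F, 1 • u + t • v ∈ Submodule.span F {u, v} := fun t =>
      Submodule.mem_span_pair.2 ⟨1, t, by rw [one_smul, one_smul]⟩
    refine ⟨_, mem _, _, mem _, key s hs, key (-s) (by rw [hs]; ring), ?_⟩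
    have e : ∀ a b : F, polar Q (1 • u + a • v) (1 • u + b • v) =
        2 * Q u + (a + b) * polar Q u v + 2 * a * b * Q v := by
      intro a b
      simp only [one_smul, QuadraticMap.polar_add_left, QuadraticMap.polar_add_right,
        polar_smul_left, polar_smul_right, polar_self, polar_comm Q v u, smul_eq_mul, nsmul_eq_mul]
      push_cast
      ring
    rw [e]
    intro h1
    apply h0
    apply mul_left_cancel₀ h2
    rw [disc] at hs ⊢
    field_simp at h1
    linear_combination (-1 : F) * h1 + hs

/-- Completing the square: `Q (a • u + b • v) = 0` gives `b ^ 2 * disc = (2 * a * Q u + b * polar Q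
u v) ^ 2`. -/
theorem isSquare_disc_of_singular {w : V} (hw : w ∈ Submodule.span F {u, v}) (hw0 : w ≠ 0)
    (hq : Q w = 0) : IsSquare (disc Q u v) := by
  obtain ⟨a, b, rfl⟩ := Submodule.mem_span_pair.1 hw
  rw [apply_add_smul] at hq
  by_cases hb : b = 0
  · subst hb
    rw [zero_smul, add_zero] at hw0
    have ha : a ≠ 0 := by rintro rfl; simp at hw0
    have hu : Q u = 0 := by
      simpa [ha] using hq
    rw [disc, hu]
    exact ⟨polar Q u v, by ring⟩
  · refine ⟨(2 * a * Q u + b * polar Q u v) / b, ?_⟩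
    rw [disc]
    field_simp
    linear_combination (-4 * Q u) * hq

end Disc

/-! ### The point sets in terms of `u`, `v` and the discriminant. -/

section Points

open QuadraticMap (polar polar_self polar_comm polar_smul_left polar_smul_right)

variable {F K : Type*} [Field F] [Field K] [Algebra F K] {n : ℕ}
  {Q : QuadraticForm F (Fin n → F)} {d : F} {e : K}

theorem mk_mem_quadric {w : Fin n → F} (hw : w ≠ 0) :
    Projectivization.mk F w hw ∈ quadric Q ↔ Q w = 0 := by
  simp only [quadric, Set.mem_ofPred_eq, Projectivization.submodule_mk]
  constructor
  · exact fun h => h w (Submodule.mem_span_singleton_self w)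
  · intro h v hv
    obtain ⟨a, rfl⟩ := Submodule.mem_span_singleton.1 hv
    rw [QuadraticMap.map_smul, h, smul_zero]

theorem mk_mem_points {w : Fin n → F} (hw : w ≠ 0) (l : Submodule F (Fin n → F)) :
    Projectivization.mk F w hw ∈ points l ↔ w ∈ l := Iff.rfl

theorem incl_ne_zero {w : Fin n → F} (hw : w ≠ 0) : incl K w ≠ 0 := fun h =>
  hw (incl_injective K (h.trans (map_zero (incl K)).symm))

theorem embed_mk {w : Fin n → F} (hw : w ≠ 0) :
    embed K (Projectivization.mk F w hw) = Projectivization.mk K (incl K w) (incl_ne_zero hw) := rfl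

theorem mk_mem_hermitian_iff {x : Fin n → K} (hx : x ≠ 0) :
    Projectivization.mk K x hx ∈ hermitian K Q ↔ hermForm K Q x x = 0 := by
  simp only [hermitian, Set.mem_ofPred_eq, Projectivization.submodule_mk]
  constructor
  · exact fun h => h x (Submodule.mem_span_singleton_self x)
  · intro h v hv
    obtain ⟨a, rfl⟩ := Submodule.mem_span_singleton.1 hv
    have : tau F K (a • x) = a ^ Nat.card F • tau F K x := by
      ext i; simp [tau, mul_pow]
    rw [hermForm] at h
    rw [hermForm, this, map_smul, map_smul, LinearMap.smul_apply, h, smul_zero, smul_zero]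

namespace IsQuadGen

theorem mk_mem_hermitian [Finite F] (h : IsQuadGen d e) {u v : Fin n → F} (hx : comb e u v ≠ 0) :
    Projectivization.mk K _ hx ∈ hermitian K Q ↔ Q u = d * Q v := by
  rw [mk_mem_hermitian_iff, h.hermForm_self, map_eq_zero, mul_eq_zero, or_iff_right h.two_ne_zero,
    sub_eq_zero]

theorem smul_incl (h : IsQuadGen d e) (a b : F) (w : Fin n → F) :
    (algebraMap F K a + e * algebraMap F K b) • incl K w = comb e (a • w) (b • w) := by
  have := h.smul_comb a b w 0
  simpa [comb] using this

theorem exists_of_embed_eq (h : IsQuadGen d e) {u v w : Fin n → F} (hx : comb e u v ≠ 0)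
    (hw : w ≠ 0) (hP : embed K (Projectivization.mk F w hw) = Projectivization.mk K _ hx) :
    ∃ a b : F, u = a • w ∧ v = b • w := by
  rw [embed_mk] at hP
  obtain ⟨z, hz⟩ := (Projectivization.mk_eq_mk_iff' ..).1 hP.symm
  obtain ⟨a, b, rfl⟩ := h.exists_eq z
  rw [h.smul_incl] at hz
  obtain ⟨rfl, rfl⟩ := h.comb_injective hz
  exact ⟨a, b, rfl, rfl⟩

theorem embed_eq (h : IsQuadGen d e) {w : Fin n → F} {a b : F} (hx : comb e (a • w) (b • w) ≠ 0)
    (hw : w ≠ 0) : embed K (Projectivization.mk F w hw) = Projectivization.mk K _ hx := by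
  rw [embed_mk]
  exact ((Projectivization.mk_eq_mk_iff' ..).2 ⟨_, h.smul_incl a b w⟩).symm

theorem mk_mem_range_embed (h : IsQuadGen d e) {u v : Fin n → F} (hx : comb e u v ≠ 0) :
    Projectivization.mk K _ hx ∈ Set.range (embed (F := F) (n := n) K) ↔
      ¬LinearIndependent F ![u, v] := by
  constructor
  · rintro ⟨P, hP⟩ hi
    induction P using Projectivization.ind with
    | h w hw =>
      obtain ⟨a, b, rfl, rfl⟩ := h.exists_of_embed_eq hx hw hP
      obtain ⟨rfl, ha⟩ := LinearIndependent.pair_iff.1 hi b (-a) (by module)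
      obtain rfl := neg_eq_zero.1 ha
      simp [comb] at hx
  · intro hi
    obtain ⟨w, a, b, rfl, rfl⟩ := exists_smul_of_not_linearIndependent hi
    have hw : w ≠ 0 := by
      rintro rfl
      simp [comb] at hx
    exact ⟨_, h.embed_eq hx hw⟩

theorem mk_mem_setQ (h : IsQuadGen d e) {u v : Fin n → F} (hx : comb e u v ≠ 0) :
    Projectivization.mk K _ hx ∈ setQ K Q ↔
      Q u = d * Q v ∧ ¬LinearIndependent F ![u, v] := by
  constructor
  · rintro ⟨P, hq, hP⟩
    refine ⟨?_, (h.mk_mem_range_embed hx).1 ⟨P, hP⟩⟩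
    induction P using Projectivization.ind with
    | h w hw =>
      obtain ⟨a, b, rfl, rfl⟩ := h.exists_of_embed_eq hx hw hP
      rw [mk_mem_quadric] at hq
      simp [QuadraticMap.map_smul, hq]
  · rintro ⟨hq, hi⟩
    obtain ⟨w, a, b, rfl, rfl⟩ := exists_smul_of_not_linearIndependent hi
    have hw : w ≠ 0 := by
      rintro rfl
      simp [comb] at hx
    refine ⟨_, (mk_mem_quadric hw).2 ?_, h.embed_eq hx hw⟩
    -- With `u = a • w` and `v = b • w`, a nonsingular `w` would give `a ^ 2 = d * b ^ 2`,
    -- impossible for a nonsquare `d`.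
    by_contra hw0
    simp only [QuadraticMap.map_smul, smul_eq_mul] at hq
    have hab : a * a = d * (b * b) := mul_right_cancel₀ hw0 (by rw [hq]; ring)
    by_cases hb : b = 0
    · subst hb
      have ha : a = 0 := by simpa using hab
      subst ha
      simp [comb] at hx
    · refine h.not_isSquare ⟨a / b, ?_⟩
      field_simp
      rw [sq, sq, hab]

/-- The vectors with both parts in `l` already form a `K`-subspace. Hence for independent `u, v` the
only line whose extension contains the point is their span. -/
theorem comb_mem_extend (h : IsQuadGen d e) {u v : Fin n → F} {l : Submodule F (Fin n → F)} :
    comb e u v ∈ extend K l ↔ u ∈ l ∧ v ∈ l := by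
  constructor
  · intro hx
    have key : ∀ x ∈ extend K l, ∃ u ∈ l, ∃ v ∈ l, x = comb e u v := by
      intro x hx
      induction hx using Submodule.span_induction with
      | mem x hx =>
        obtain ⟨w, hw, rfl⟩ := hx
        exact ⟨w, hw, 0, l.zero_mem, by simp [comb]⟩
      | zero => exact ⟨0, l.zero_mem, 0, l.zero_mem, comb_zero.symm⟩
      | add x y _ _ hx hy =>
        obtain ⟨u, hu, v, hv, rfl⟩ := hx
        obtain ⟨u', hu', v', hv', rfl⟩ := hy
        refine ⟨u + u', l.add_mem hu hu', v + v', l.add_mem hv hv', ?_⟩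
        simp only [comb, map_add, smul_add]
        abel
      | smul z x _ hx =>
        obtain ⟨u, hu, v, hv, rfl⟩ := hx
        obtain ⟨a, b, rfl⟩ := h.exists_eq z
        rw [h.smul_comb]
        exact ⟨_, l.add_mem (l.smul_mem _ hu) (l.smul_mem _ hv), _,
          l.add_mem (l.smul_mem _ hu) (l.smul_mem _ hv), rfl⟩
    obtain ⟨u', hu', v', hv', he⟩ := key _ hx
    obtain ⟨rfl, rfl⟩ := h.comb_injective he
    exact ⟨hu', hv'⟩
  · rintro ⟨hu, hv⟩
    exact Submodule.add_mem _ (Submodule.subset_span ⟨u, hu, rfl⟩)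
      (Submodule.smul_mem _ _ (Submodule.subset_span ⟨v, hv, rfl⟩))

theorem mk_mem_setO (h : IsQuadGen d e) {u v : Fin n → F} (hx : comb e u v ≠ 0) :
    Projectivization.mk K _ hx ∈ setO K Q ↔
      Q u = d * Q v ∧ LinearIndependent F ![u, v] ∧ disc Q u v = 0 := by
  simp only [setO, Set.mem_ofPred_eq, h.mk_mem_range_embed, not_not]
  constructor
  · rintro ⟨hi, l, -, hq, hl⟩
    obtain ⟨hu, hv⟩ := h.comb_mem_extend.1 hl
    have key : ∀ w ∈ l, Q w = 0 := by
      intro w hw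
      by_cases hw0 : w = 0
      · rw [hw0, QuadraticMap.map_zero]
      · exact (mk_mem_quadric hw0).1 (hq ((mk_mem_points hw0 l).2 hw))
    refine ⟨by rw [key u hu, key v hv, mul_zero], hi, ?_⟩
    rw [disc, polar, key _ (l.add_mem hu hv), key u hu, key v hv]
    ring
  · rintro ⟨hq, hi, hd⟩
    obtain ⟨hu, hv, huv⟩ := eq_zero_of_disc_eq_zero h.two_ne_zero h.not_isSquare hq hd
    refine ⟨hi, Submodule.span F {u, v}, finrank_span_pair hi, ?_, h.comb_mem_extend.2
      ⟨Submodule.subset_span (by simp), Submodule.subset_span (by simp)⟩⟩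
    intro P
    induction P using Projectivization.ind with
    | h w hw =>
      rw [mk_mem_points, mk_mem_quadric]
      intro hw'
      obtain ⟨a, b, rfl⟩ := Submodule.mem_span_pair.1 hw'
      rw [apply_add_smul, hu, hv, huv]; ring

theorem mk_mem_setE [Finite F] (h : IsQuadGen d e) {u v : Fin n → F} (hx : comb e u v ≠ 0) :
    Projectivization.mk K _ hx ∈ setE K Q ↔ Q u = d * Q v ∧ ¬IsSquare (disc Q u v) := by
  simp only [setE, Set.mem_ofPred_eq, h.mk_mem_hermitian]
  refine and_congr_right fun hq => ?_
  constructor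
  · rintro ⟨l, hl, hlq, hx'⟩ hs
    obtain ⟨hu, hv⟩ := h.comb_mem_extend.1 hx'
    have key : ∀ w ∈ l, Q w = 0 → w = 0 := by
      intro w hw hw1
      by_contra hw0
      exact (hlq.subset ⟨(mk_mem_points hw0 l).2 hw, (mk_mem_quadric hw0).2 hw1⟩).elim
    -- A vanishing discriminant makes `u` and `v` singular, hence zero on an external line; a
    -- nonzero square would put a singular pair on it.
    by_cases hd : disc Q u v = 0
    · obtain ⟨hu0, hv0, -⟩ := eq_zero_of_disc_eq_zero h.two_ne_zero h.not_isSquare hq hd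
      apply hx
      rw [key u hu hu0, key v hv hv0, comb_zero]
    · obtain ⟨f, hf, g, hg, hf0, hg0, hfg⟩ := exists_singular_pair h.two_ne_zero hq hs hd
      rw [← eq_span_pair hl hu hv (linearIndependent_of_disc_ne_zero hd)] at hf
      apply hfg
      rw [key f hf hf0, QuadraticMap.polar_zero_left]
  · intro hd
    have hi := linearIndependent_of_disc_ne_zero (Q := Q) (u := u) (v := v)
      (by intro h0; rw [h0] at hd; exact hd .zero)
    refine ⟨Submodule.span F {u, v}, finrank_span_pair hi, ?_, h.comb_mem_extend.2
      ⟨Submodule.subset_span (by simp), Submodule.subset_span (by simp)⟩⟩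
    rw [Set.eq_empty_iff_forall_notMem]
    intro P
    induction P using Projectivization.ind with
    | h w hw =>
      rintro ⟨h1, h3⟩
      exact hd (isSquare_disc_of_singular ((mk_mem_points hw _).1 h1) hw
        ((mk_mem_quadric hw).1 h3))

theorem mk_mem_setS [Finite F] (h : IsQuadGen d e) {u v : Fin n → F} (hx : comb e u v ≠ 0) :
    Projectivization.mk K _ hx ∈ setS K Q ↔
      Q u = d * Q v ∧ IsSquare (disc Q u v) ∧ disc Q u v ≠ 0 := by
  simp only [setS, Set.mem_ofPred_eq, Set.mem_sdiff, h.mk_mem_hermitian, h.mk_mem_setQ]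
  constructor
  · rintro ⟨⟨hq, hi⟩, l, hl, hc, hx'⟩
    have hi : LinearIndependent F ![u, v] := by
      by_contra h1
      exact hi ⟨hq, h1⟩
    obtain ⟨hu, hv⟩ := h.comb_mem_extend.1 hx'
    have hsub : ∀ w ∈ l, ∃ a b : F, a • u + b • v = w := by
      intro w hw
      rw [eq_span_pair hl hu hv hi] at hw
      exact Submodule.mem_span_pair.1 hw
    obtain ⟨A, B, hAB, hset⟩ := Set.ncard_eq_two.1 hc
    refine ⟨hq, ?_, ?_⟩
    · have hA : A ∈ points l ∩ quadric Q := by rw [hset]; simp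
      clear hAB hset
      induction A using Projectivization.ind with
      | h w hw =>
        refine isSquare_disc_of_singular ?_ hw ((mk_mem_quadric hw).1 hA.2)
        rw [← eq_span_pair hl hu hv hi]
        exact (mk_mem_points hw l).1 hA.1
    · intro hd
      -- The line would be totally singular, yet `u`, `v` and `u + v` give three distinct points
      -- where only two are allowed.
      obtain ⟨hu0, hv0, huv⟩ := eq_zero_of_disc_eq_zero h.two_ne_zero h.not_isSquare hq hd
      rw [LinearIndependent.pair_iff] at hi
      have hu' : u ≠ 0 := by
        rintro rfl
        exact one_ne_zero (hi 1 0 (by simp)).1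
      have hv' : v ≠ 0 := by
        rintro rfl
        exact one_ne_zero (hi 0 1 (by simp)).2
      have huv' : u + v ≠ 0 := by
        intro h0
        exact one_ne_zero (hi 1 1 (by simpa using h0)).1
      have mem : ∀ (w : Fin n → F) (hw : w ≠ 0), w ∈ l → Q w = 0 →
          Projectivization.mk F w hw = A ∨ Projectivization.mk F w hw = B := by
        intro w hw hwl hq0
        have : Projectivization.mk F w hw ∈ points l ∩ quadric Q :=
          ⟨(mk_mem_points hw l).2 hwl, (mk_mem_quadric hw).2 hq0⟩
        rw [hset] at this
        exact this
      have n1 : Projectivization.mk F u hu' ≠ Projectivization.mk F v hv' := by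
        rw [Ne, Projectivization.mk_eq_mk_iff']
        rintro ⟨a, ha⟩
        exact one_ne_zero (hi 1 (-a) (by rw [← ha]; module)).1
      have n2 : Projectivization.mk F (u + v) huv' ≠ Projectivization.mk F u hu' := by
        rw [Ne, Projectivization.mk_eq_mk_iff']
        rintro ⟨a, ha⟩
        exact one_ne_zero (hi (1 - a) 1 (by rw [sub_smul, ha]; module)).2
      have n3 : Projectivization.mk F (u + v) huv' ≠ Projectivization.mk F v hv' := by
        rw [Ne, Projectivization.mk_eq_mk_iff']
        rintro ⟨a, ha⟩
        exact one_ne_zero (hi 1 (1 - a) (by rw [sub_smul, ha]; module)).1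
      have m1 := mem u hu' hu hu0
      have m2 := mem v hv' hv hv0
      have m3 := mem (u + v) huv' (l.add_mem hu hv) (by
        rw [QuadraticMap.map_add Q, hu0, hv0, huv]; simp)
      grind
  · rintro ⟨hq, hs, hd⟩
    have hi := linearIndependent_of_disc_ne_zero hd
    refine ⟨⟨hq, fun h1 => h1.2 hi⟩, Submodule.span F {u, v}, finrank_span_pair hi, ?_,
      h.comb_mem_extend.2 ⟨Submodule.subset_span (by simp), Submodule.subset_span (by simp)⟩⟩
    obtain ⟨f, hf, g, hg, hf0, hg0, hfg⟩ := exists_singular_pair h.two_ne_zero hq hs hd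
    have hfg' : LinearIndependent F ![f, g] :=
      linearIndependent_of_disc_ne_zero (Q := Q) (by simpa [disc, hf0, hg0] using hfg)
    rw [eq_span_pair (finrank_span_pair hi) hf hg hfg', Set.ncard_eq_two]
    have hf' : f ≠ 0 := by
      rintro rfl
      simp at hfg
    have hg' : g ≠ 0 := by
      rintro rfl
      simp at hfg
    refine ⟨Projectivization.mk F f hf', Projectivization.mk F g hg', ?_, ?_⟩
    · rw [Ne, Projectivization.mk_eq_mk_iff']
      rintro ⟨a, ha⟩
      exact one_ne_zero (LinearIndependent.pair_iff.1 hfg' 1 (-a) (by rw [← ha]; module)).1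
    · ext P
      induction P using Projectivization.ind with
      | h w hw =>
        rw [Set.mem_inter_iff, mk_mem_points, mk_mem_quadric, Set.mem_insert_iff,
          Set.mem_singleton_iff, Projectivization.mk_eq_mk_iff', Projectivization.mk_eq_mk_iff',
          Submodule.mem_span_pair]
        constructor
        · rintro ⟨⟨a, b, rfl⟩, hw0⟩
          rw [apply_add_smul, hf0, hg0] at hw0
          have hab : a = 0 ∨ b = 0 := by simpa [hfg] using hw0
          rcases hab with rfl | rfl
          · exact .inr ⟨b, by simp⟩
          · exact .inl ⟨a, by simp⟩
        · rintro (⟨a, rfl⟩ | ⟨a, rfl⟩)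
          · exact ⟨⟨a, 0, by simp⟩, by simp [QuadraticMap.map_smul, hf0]⟩
          · exact ⟨⟨0, a, by simp⟩, by simp [QuadraticMap.map_smul, hg0]⟩

end IsQuadGen

end Points

/-! ### Invariance, transitivity and the partition of the Hermitian variety. -/

section Orbits

open QuadraticMap (polar polar_self polar_comm polar_smul_left polar_smul_right)

variable {F K : Type*} [Field F] [Field K] [Algebra F K] {n : ℕ}
  {Q : QuadraticForm F (Fin n → F)} {d : F} {e : K}

theorem mem_groupG {γ : PGL(n, K)} : γ ∈ groupG K Q ↔ ∃ g ∈ similitudeGroup Q,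
    Matrix.ProjGenLinGroup.mk (Matrix.GeneralLinearGroup.map (algebraMap F K) g) = γ := by
  constructor
  · rintro ⟨_, ⟨g, hg, rfl⟩, rfl⟩
    exact ⟨g, hg, rfl⟩
  · rintro ⟨g, hg, rfl⟩
    exact ⟨_, ⟨g, hg, rfl⟩, rfl⟩

theorem comb_mulVec_ne_zero (g : GL (Fin n) F) {u v : Fin n → F} (hx : comb e u v ≠ 0) :
    comb e (g.1.mulVec u) (g.1.mulVec v) ≠ 0 := by
  rw [← mulVec_comb]
  exact (smul_ne_zero_iff_ne (Matrix.GeneralLinearGroup.map (algebraMap F K) g)).2 hx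

theorem mk_map_smul_mk (g : GL (Fin n) F) {u v : Fin n → F} (hx : comb e u v ≠ 0) :
    (Matrix.ProjGenLinGroup.mk (Matrix.GeneralLinearGroup.map (algebraMap F K) g) : PGL(n, K)) •
      Projectivization.mk K _ hx = Projectivization.mk K _ (comb_mulVec_ne_zero g hx) := by
  rw [Projectivization.PGL.mk_smul_mk]
  congr 1
  exact mulVec_comb g u v

theorem polar_similitude {g : GL (Fin n) F} {c : F} (hg : ∀ v, Q (g.1.mulVec v) = c * Q v)
    (u v : Fin n → F) : polar Q (g.1.mulVec u) (g.1.mulVec v) = c * polar Q u v := by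
  rw [polar, ← Matrix.mulVec_add, hg, hg, hg, polar]
  ring

theorem disc_similitude {g : GL (Fin n) F} {c : F} (hg : ∀ v, Q (g.1.mulVec v) = c * Q v)
    (u v : Fin n → F) : disc Q (g.1.mulVec u) (g.1.mulVec v) = c ^ 2 * disc Q u v := by
  rw [disc, polar_similitude hg, hg, hg, disc]
  ring

theorem linearIndependent_mulVec (g : GL (Fin n) F) {u v : Fin n → F} :
    LinearIndependent F ![g.1.mulVec u, g.1.mulVec v] ↔ LinearIndependent F ![u, v] := by
  have key : ∀ (g : GL (Fin n) F) (u v : Fin n → F), LinearIndependent F ![u, v] →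
      LinearIndependent F ![g.1.mulVec u, g.1.mulVec v] := by
    intro g u v hi
    rw [LinearIndependent.pair_iff] at hi ⊢
    intro s t hst
    apply hi
    rw [← Matrix.mulVec_smul, ← Matrix.mulVec_smul, ← Matrix.mulVec_add] at hst
    have := congrArg (g⁻¹.1.mulVec ·) hst
    simpa [Matrix.mulVec_mulVec] using this
  refine ⟨fun hi => ?_, key g u v⟩
  have := key g⁻¹ _ _ hi
  simpa [Matrix.mulVec_mulVec] using this

theorem isSquare_sq_mul_iff {c : F} (hc : c ≠ 0) (x : F) : IsSquare (c ^ 2 * x) ↔ IsSquare x := by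
  constructor
  · rintro ⟨s, hs⟩
    refine ⟨s / c, ?_⟩
    field_simp
    linear_combination hs
  · rintro ⟨s, rfl⟩
    exact ⟨c * s, by ring⟩

/-- Every isometry mapping the real and imaginary parts of one vector to those of another
induces an element of the group. -/
theorem exists_smul_eq_of_isometryEquiv {u v u' v' : Fin n → F} (hx : comb e u v ≠ 0)
    (hx' : comb e u' v' ≠ 0) (h : ∃ g : Q.IsometryEquiv Q, g u = u' ∧ g v = v') :
    ∃ γ ∈ groupG K Q, γ • Projectivization.mk K _ hx = Projectivization.mk K _ hx' := by
  obtain ⟨g, rfl, rfl⟩ := h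
  let A : GL (Fin n) F := Matrix.GeneralLinearGroup.toLin.symm
    (LinearMap.GeneralLinearGroup.ofLinearEquiv g.toLinearEquiv)
  have hA : ∀ w, A.1.mulVec w = g w := by
    intro w
    have h1 := Matrix.GeneralLinearGroup.coe_toLin (A := A)
    rw [← Matrix.mulVecLin_apply, ← h1]
    simp only [A, MulEquiv.apply_symm_apply]
    rfl
  refine ⟨_, mem_groupG.2 ⟨A, ⟨1, fun w => ?_⟩, rfl⟩, ?_⟩
  · rw [hA, g.map_app, Units.val_one, one_mul]
  · rw [mk_map_smul_mk]
    simp only [hA]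

theorem orbit_eq {X : Set (ℙ K (Fin n → K))}
    (hX : ∀ γ ∈ groupG K Q, ∀ P, γ • P ∈ X ↔ P ∈ X)
    (ht : ∀ P ∈ X, ∀ P' ∈ X, ∃ γ ∈ groupG K Q, γ • P = P') {P : ℙ K (Fin n → K)} (hP : P ∈ X) :
    MulAction.orbit (groupG K Q) P = X := by
  ext P'
  constructor
  · rintro ⟨γ, rfl⟩
    exact (hX γ γ.2 P).2 hP
  · intro hP'
    obtain ⟨γ, hγ, rfl⟩ := ht P hP P' hP'
    exact ⟨⟨γ, hγ⟩, rfl⟩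

namespace IsQuadGen

theorem ind (h : IsQuadGen d e) {p : ℙ K (Fin n → K) → Prop}
    (hp : ∀ (u v : Fin n → F) (hx : comb e u v ≠ 0), p (Projectivization.mk K _ hx)) :
    ∀ P, p P := by
  intro P
  induction P using Projectivization.ind with
  | h x hx =>
    obtain ⟨u, v, rfl⟩ := h.exists_comb x
    exact hp u v hx

/-- A similitude with multiplier `c` scales both sides of `Q u = d * Q v` by `c` and the
discriminant by `c ^ 2`, so each coordinate criterion is preserved. -/
theorem smul_mem_iff [Finite F] (h : IsQuadGen d e) {γ : PGL(n, K)} (hγ : γ ∈ groupG K Q)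
    (P : ℙ K (Fin n → K)) : (γ • P ∈ hermitian K Q ↔ P ∈ hermitian K Q) ∧
      (γ • P ∈ setQ K Q ↔ P ∈ setQ K Q) ∧ (γ • P ∈ setO K Q ↔ P ∈ setO K Q) ∧
      (γ • P ∈ setE K Q ↔ P ∈ setE K Q) ∧ (γ • P ∈ setS K Q ↔ P ∈ setS K Q) := by
  obtain ⟨g, ⟨c, hc⟩, rfl⟩ := mem_groupG.1 hγ
  revert P
  refine h.ind fun u v hx => ?_
  have hq : ((c : F) * Q u = d * (c * Q v)) ↔ Q u = d * Q v := by
    rw [mul_left_comm, mul_right_inj' c.ne_zero]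
  have hd : (c : F) ^ 2 * disc Q u v = 0 ↔ disc Q u v = 0 := by
    rw [mul_eq_zero, or_iff_right (pow_ne_zero _ c.ne_zero)]
  rw [mk_map_smul_mk]
  simp only [h.mk_mem_hermitian, h.mk_mem_setQ, h.mk_mem_setO, h.mk_mem_setE, h.mk_mem_setS,
    linearIndependent_mulVec, disc_similitude hc, hc, hq, hd, isSquare_sq_mul_iff c.ne_zero, ne_eq,
    and_self]

/-- Two points of the Hermitian variety whose discriminants are nonzero and lie in the same square
class have representatives with the same Gram matrix. -/
theorem exists_smul_comb_eq [Finite F] [Finite K] (h : IsQuadGen d e) {u v u' v' : Fin n → F}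
    (hq : Q u = d * Q v) (hq' : Q u' = d * Q v') (h0 : disc Q u v ≠ 0) (h0' : disc Q u' v' ≠ 0)
    (hs : IsSquare (disc Q u v * disc Q u' v')) :
    ∃ (z : K) (u₁ v₁ : Fin n → F), z ≠ 0 ∧ z • comb e u v = comb e u₁ v₁ ∧ Q u₁ = Q u' ∧
      Q v₁ = Q v' ∧ polar Q u₁ v₁ = polar Q u' v' := by
  have ne : ∀ u v : Fin n → F, Q u = d * Q v → disc Q u v ≠ 0 →
      polarExt K Q (comb e u v) (comb e u v) ≠ 0 := by
    intro u v hq h0 h1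
    rw [h.polarExt_self] at h1
    obtain ⟨h1, h3⟩ := coe_add_mul_eq_zero h.sq_eq h.not_isSquare h1
    apply h0
    have h4 := (mul_eq_zero.1 h3).resolve_left h.two_ne_zero
    have h5 := (mul_eq_zero.1 h1).resolve_left h.two_ne_zero
    have h6 : 2 * Q u = 0 := by linear_combination h5 + hq
    rw [disc, h4, (mul_eq_zero.1 h6).resolve_left h.two_ne_zero]
    ring
  have n1 := ne u v hq h0
  have n2 := ne u' v' hq' h0'
  have hsq : IsSquare (polarExt K Q (comb e u v) (comb e u v) *
      polarExt K Q (comb e u' v') (comb e u' v')) := by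
    have n3 := mul_ne_zero n1 n2
    have e1 : polarExt K Q (comb e u v) (comb e u v) *
        polarExt K Q (comb e u' v') (comb e u' v') =
        algebraMap F K (2 * (Q u + d * Q v) * (2 * (Q u' + d * Q v')) +
          d * (2 * polar Q u v) * (2 * polar Q u' v')) +
        e * algebraMap F K (2 * (Q u + d * Q v) * (2 * polar Q u' v') +
          2 * polar Q u v * (2 * (Q u' + d * Q v'))) := by
      rw [h.polarExt_self, h.polarExt_self]
      simp only [map_add, map_mul, ← h.sq_eq]
      ring
    rw [e1] at n3 ⊢
    rw [h.isSquare_iff n3]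
    obtain ⟨s, hs⟩ := hs
    -- The norm of `B(x, x)` is `-4 * d * disc`, so the norm of the product is `(4 * d) ^ 2` times
    -- the product `s * s` of the discriminants.
    refine ⟨4 * d * s, ?_⟩
    rw [disc, disc, hq, hq'] at hs
    rw [hq, hq']
    linear_combination 16 * d ^ 2 * hs
  obtain ⟨s, hs⟩ := hsq
  set p := polarExt K Q (comb e u v) (comb e u v) with hp
  -- Scaling by `s / p` changes `B(x, x) = p` into `s ^ 2 / p`, the value at the second vector.
  obtain ⟨u₁, v₁, hz⟩ := h.exists_comb ((s / p) • comb e u v)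
  have hs0 : s ≠ 0 := by
    rintro rfl
    exact mul_ne_zero n1 n2 (by rw [hs, mul_zero])
  have hz0 : s / p ≠ 0 := div_ne_zero hs0 n1
  have hx : comb e u v ≠ 0 := by
    intro hx
    rw [hp, hx] at n1
    simp at n1
  have hq₁ : Q u₁ = d * Q v₁ := by
    have hx₁ : comb e u₁ v₁ ≠ 0 := by
      rw [← hz]
      exact smul_ne_zero hz0 hx
    rw [← h.mk_mem_hermitian hx₁]
    have : Projectivization.mk K _ hx₁ = Projectivization.mk K _ hx :=
      (Projectivization.mk_eq_mk_iff' ..).2 ⟨_, hz⟩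
    rw [this, h.mk_mem_hermitian hx, hq]
  have e2 : polarExt K Q (comb e u₁ v₁) (comb e u₁ v₁) =
      polarExt K Q (comb e u' v') (comb e u' v') := by
    rw [← hz, map_smul, map_smul, LinearMap.smul_apply, ← hp, smul_eq_mul, smul_eq_mul]
    field_simp
    rw [sq, ← hs]
  rw [h.polarExt_self, h.polarExt_self] at e2
  have e3 := coe_add_mul_eq_zero h.sq_eq h.not_isSquare
    (a := 2 * (Q u₁ + d * Q v₁) - 2 * (Q u' + d * Q v'))
    (b := 2 * polar Q u₁ v₁ - 2 * polar Q u' v') (by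
      rw [map_sub, map_sub]
      linear_combination e2)
  have e4 : Q u₁ = Q u' := by
    apply mul_left_cancel₀ (mul_ne_zero h.two_ne_zero h.two_ne_zero)
    linear_combination e3.1 + 2 * hq₁ - 2 * hq'
  have hd : d ≠ 0 := by
    rintro rfl
    exact h.not_isSquare .zero
  refine ⟨s / p, u₁, v₁, hz0, hz, e4, ?_, ?_⟩
  · apply mul_left_cancel₀ hd
    rw [← hq₁, ← hq', e4]
  · apply mul_left_cancel₀ h.two_ne_zero
    linear_combination e3.2

theorem exists_smul_eq_of_disc_ne_zero [Finite F] [Finite K] (h : IsQuadGen d e)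
    {u v u' v' : Fin n → F} (hx : comb e u v ≠ 0) (hx' : comb e u' v' ≠ 0)
    (hq : Q u = d * Q v) (hq' : Q u' = d * Q v') (h0 : disc Q u v ≠ 0) (h0' : disc Q u' v' ≠ 0)
    (hs : IsSquare (disc Q u v * disc Q u' v')) :
    ∃ γ ∈ groupG K Q, γ • Projectivization.mk K _ hx = Projectivization.mk K _ hx' := by
  obtain ⟨z, u₁, v₁, hz0, hz, h1, h3, h4⟩ := h.exists_smul_comb_eq hq hq' h0 h0' hs
  have hx₁ : comb e u₁ v₁ ≠ 0 := by
    rw [← hz]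
    exact smul_ne_zero hz0 hx
  have e1 : Projectivization.mk K _ hx₁ = Projectivization.mk K _ hx :=
    (Projectivization.mk_eq_mk_iff' ..).2 ⟨_, hz⟩
  rw [← e1]
  refine exists_smul_eq_of_isometryEquiv hx₁ hx'
    (exists_isometryEquiv_pair h.two_ne_zero h1 h3 h4 ?_ ?_)
  · rw [h1, h3, h4]
    exact h0'
  · intro h5
    rw [h1, hq', ← h3, h5, mul_zero]

theorem exists_smul_eq_setQ (h : IsQuadGen d e) (hQ : Q.polarBilin.Nondegenerate) :
    ∀ P ∈ setQ K Q, ∀ P' ∈ setQ K Q, ∃ γ ∈ groupG K Q, γ • P = P' := by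
  rintro _ ⟨P, hP, rfl⟩ _ ⟨P', hP', rfl⟩
  induction P using Projectivization.ind with
  | h w hw =>
    induction P' using Projectivization.ind with
    | h w' hw' =>
      rw [mk_mem_quadric] at hP hP'
      have e1 : ∀ w : Fin n → F, comb e ((1 : F) • w) ((0 : F) • w) = incl K w := by
        intro w; simp [comb]
      have n1 : comb e ((1 : F) • w) ((0 : F) • w) ≠ 0 := by
        rw [e1]; exact incl_ne_zero hw
      have n2 : comb e ((1 : F) • w') ((0 : F) • w') ≠ 0 := by
        rw [e1]; exact incl_ne_zero hw'
      rw [h.embed_eq n1 hw, h.embed_eq n2 hw']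
      obtain ⟨g, hg⟩ := exists_isometryEquiv_singular h.two_ne_zero hQ hw hw' hP hP'
      exact exists_smul_eq_of_isometryEquiv n1 n2 ⟨g, by simp [hg], by simp⟩

theorem exists_smul_eq_setO (h : IsQuadGen d e) (hQ : Q.polarBilin.Nondegenerate) :
    ∀ P ∈ setO K Q, ∀ P' ∈ setO K Q, ∃ γ ∈ groupG K Q, γ • P = P' := by
  refine h.ind fun u v hx hP => h.ind fun u' v' hx' hP' => ?_
  obtain ⟨hq, hi, hd⟩ := (h.mk_mem_setO hx).1 hP
  obtain ⟨hq', hi', hd'⟩ := (h.mk_mem_setO hx').1 hP'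
  obtain ⟨h1, h3, h4⟩ := eq_zero_of_disc_eq_zero h.two_ne_zero h.not_isSquare hq hd
  obtain ⟨h1', h3', h4'⟩ := eq_zero_of_disc_eq_zero h.two_ne_zero h.not_isSquare hq' hd'
  exact exists_smul_eq_of_isometryEquiv hx hx'
    (exists_isometryEquiv_totallySingular h.two_ne_zero hQ hi hi' h1 h3 h4 h1' h3' h4')

theorem exists_smul_eq_setS [Finite F] [Finite K] (h : IsQuadGen d e) :
    ∀ P ∈ setS K Q, ∀ P' ∈ setS K Q, ∃ γ ∈ groupG K Q, γ • P = P' := by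
  refine h.ind fun u v hx hP => h.ind fun u' v' hx' hP' => ?_
  obtain ⟨hq, hs, hd⟩ := (h.mk_mem_setS hx).1 hP
  obtain ⟨hq', hs', hd'⟩ := (h.mk_mem_setS hx').1 hP'
  exact h.exists_smul_eq_of_disc_ne_zero hx hx' hq hq' hd hd' (hs.mul hs')

theorem exists_smul_eq_setE [Finite F] [Finite K] (h : IsQuadGen d e) :
    ∀ P ∈ setE K Q, ∀ P' ∈ setE K Q, ∃ γ ∈ groupG K Q, γ • P = P' := by
  classical
  have := Fintype.ofFinite F
  refine h.ind fun u v hx hP => h.ind fun u' v' hx' hP' => ?_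
  obtain ⟨hq, hs⟩ := (h.mk_mem_setE hx).1 hP
  obtain ⟨hq', hs'⟩ := (h.mk_mem_setE hx').1 hP'
  have ne : ∀ x : F, ¬IsSquare x → x ≠ 0 := by
    rintro x hx rfl
    exact hx .zero
  refine h.exists_smul_eq_of_disc_ne_zero hx hx' hq hq' (ne _ hs) (ne _ hs') ?_
  rw [← quadraticChar_one_iff_isSquare (mul_ne_zero (ne _ hs) (ne _ hs')), map_mul,
    quadraticChar_neg_one_iff_not_isSquare.2 hs, quadraticChar_neg_one_iff_not_isSquare.2 hs']
  rfl

theorem mem_hermitian_iff [Finite F] (h : IsQuadGen d e) (P : ℙ K (Fin n → K)) :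
    P ∈ hermitian K Q ↔ P ∈ setQ K Q ∨ P ∈ setO K Q ∨ P ∈ setE K Q ∨ P ∈ setS K Q := by
  revert P
  refine h.ind fun u v hx => ?_
  rw [h.mk_mem_hermitian, h.mk_mem_setQ, h.mk_mem_setO, h.mk_mem_setE, h.mk_mem_setS]
  tauto

/-- Besides logic, this needs that dependent vectors have zero discriminant and that zero is a
square. -/
theorem disjoint_sets [Finite F] (h : IsQuadGen d e) : Disjoint (setQ K Q) (setO K Q) ∧
    Disjoint (setQ K Q) (setE K Q) ∧ Disjoint (setQ K Q) (setS K Q) ∧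
    Disjoint (setO K Q) (setE K Q) ∧ Disjoint (setO K Q) (setS K Q) ∧
    Disjoint (setE K Q) (setS K Q) := by
  simp only [Set.disjoint_left]
  simp only [← forall_and]
  refine h.ind fun u v hx => ?_
  rw [h.mk_mem_setQ, h.mk_mem_setO, h.mk_mem_setE, h.mk_mem_setS]
  have h1 := linearIndependent_of_disc_ne_zero (Q := Q) (u := u) (v := v)
  have h3 : disc Q u v = 0 → IsSquare (disc Q u v) := fun h3 => h3 ▸ .zero
  tauto

end IsQuadGen

end Orbits

/-! ### Counting pairs of vectors with prescribed values. -/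

section PairCounting

open Finset
open QuadraticMap (polar polar_self polar_comm polar_smul_left polar_smul_right polar_add_right
  polar_sub_right polar_zero_left)

variable {F : Type*} [Field F] [Fintype F] [DecidableEq F] {n k : ℕ}
  {Q : QuadraticForm F (Fin n → F)}

/-- Two translations each contribute a factor `q`: adding `t • u` preserves `polar Q u v = m` and
shifts `Q v` by `t * m`, while adding `t • y` with `polar Q u y = 1` shifts the polar value by `t`.
-/
theorem card_singular_polar_eq (hQ : Q.polarBilin.Nondegenerate) {u : Fin n → F} (hu : u ≠ 0)
    (hq : Q u = 0) {m : F} (hm : m ≠ 0) :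
    Fintype.card F ^ 2 * #{v | Q v = 0 ∧ polar Q u v = m} = Fintype.card F ^ n := by
  obtain ⟨y, hy⟩ := exists_polar_eq hQ (x := fun _ : Fin 1 => u)
    (LinearIndependent.of_subsingleton 0 hu) 1
  have hy : polar Q u y = 1 := hy 0
  have huu : polar Q u u = 0 := by rw [polar_self, hq, smul_zero]
  have h1 : Fintype.card F * #{v | Q v = 0 ∧ polar Q u v = m} = #{v | polar Q u v = m} := by
    rw [← card_univ, ← card_product]
    have e : ∀ (v : Fin n → F) (t : F), polar Q u v = m → Q (v + t • u) = Q v + t * m := by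
      intro v t hv
      rw [QuadraticMap.map_add Q, QuadraticMap.map_smul, polar_smul_right, polar_comm, hv, hq]
      simp
    refine card_bij' (fun p _ => p.2 + p.1 • u) (fun w _ => (Q w / m, w - (Q w / m) • u))
      ?_ ?_ ?_ ?_
    · rintro ⟨t, v⟩ hp
      simp only [mem_product, mem_univ, true_and, mem_filter] at hp ⊢
      rw [polar_add_right, polar_smul_right, huu, hp.2, smul_zero, add_zero]
    · intro w hw
      simp only [mem_product, mem_univ, true_and, mem_filter] at hw ⊢
      rw [sub_eq_add_neg, ← neg_smul, e _ _ hw, polar_add_right, polar_smul_right, huu, hw]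
      simp [hm]
    · rintro ⟨t, v⟩ hp
      simp only [mem_product, mem_univ, true_and, mem_filter] at hp ⊢
      rw [e _ _ hp.2, hp.1, zero_add, mul_div_cancel_right₀ _ hm]
      simp
    · intro w _
      simp
  have h2 : Fintype.card F * #{v | polar Q u v = m} = Fintype.card F ^ n := by
    rw [← card_univ, ← card_product]
    have : Fintype.card F ^ n = #(univ : Finset (Fin n → F)) := by simp
    rw [card_univ, this]
    refine card_bij' (fun p _ => p.2 + p.1 • y)
      (fun w _ => (polar Q u w - m, w - (polar Q u w - m) • y)) ?_ ?_ ?_ ?_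
    · simp
    · intro w _
      simp [polar_sub_right, polar_smul_right, hy]
    · rintro ⟨t, v⟩ hp
      simp only [mem_product, mem_univ, true_and, mem_filter] at hp ⊢
      rw [polar_add_right, polar_smul_right, hy, hp]
      simp
    · intro w _
      simp
  rw [← h2, ← h1]
  ring

theorem card_singular (hF : ringChar F ≠ 2) (hn : n = 2 * k + 1)
    (hQ : Q.polarBilin.Nondegenerate) : #{v | Q v = 0} = Fintype.card F ^ (2 * k) := by
  obtain ⟨s, -, h⟩ := card_quadraticForm_eq hF hn Q hQ
  have := h 0
  rw [MulChar.map_zero, mul_zero, add_zero] at this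
  exact_mod_cast this

theorem card_singular_polar_eq' (hk : 0 < k) (hn : n = 2 * k + 1)
    (hQ : Q.polarBilin.Nondegenerate) {u : Fin n → F} (hu : u ≠ 0)
    (hq : Q u = 0) {m : F} (hm : m ≠ 0) :
    #{v | Q v = 0 ∧ polar Q u v = m} = Fintype.card F ^ (2 * k - 1) := by
  have h := card_singular_polar_eq hQ hu hq hm
  apply Nat.eq_of_mul_eq_mul_left (pow_pos Fintype.card_pos 2 : 0 < Fintype.card F ^ 2)
  rw [h, ← pow_add, hn]
  congr 1
  omega

/-- Of the `q ^ (2 * k)` singular vectors, each of the `q - 1` nonzero polar values takes `q ^ (2 *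
k - 1)`, leaving as many for zero. -/
theorem card_singular_polar_zero (hF : ringChar F ≠ 2) (hk : 0 < k) (hn : n = 2 * k + 1)
    (hQ : Q.polarBilin.Nondegenerate) {u : Fin n → F} (hu : u ≠ 0) (hq : Q u = 0) :
    #{v | Q v = 0 ∧ polar Q u v = 0} = Fintype.card F ^ (2 * k - 1) := by
  have h := card_singular hF hn hQ
  rw [card_eq_sum_card_fiberwise (f := fun v => polar Q u v) (t := univ) (by simp)] at h
  simp only [filter_filter] at h
  rw [← add_sum_erase _ _ (mem_univ (0 : F)), sum_congr rfl fun m hm =>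
    card_singular_polar_eq' hk hn hQ hu hq (ne_of_mem_erase hm), sum_const,
    card_erase_of_mem (mem_univ _), card_univ, smul_eq_mul] at h
  have h1 : Fintype.card F ^ (2 * k) = Fintype.card F * Fintype.card F ^ (2 * k - 1) := by
    rw [← pow_succ']
    congr 1
    omega
  have h2 : Fintype.card F = Fintype.card F - 1 + 1 :=
    (Nat.sub_add_cancel Fintype.card_pos).symm
  rw [h1] at h
  generalize Fintype.card F ^ (2 * k - 1) = x at h ⊢
  nth_rw 2 [h2] at h
  rw [add_mul, one_mul] at h
  omega

theorem sum_card_pairs {V : Type*} [Fintype V] [DecidableEq V] (p : V → V → Prop)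
    [∀ u v, Decidable (p u v)] : #{x : V × V | p x.1 x.2} = ∑ u, #{v | p u v} := by
  rw [card_eq_sum_card_fiberwise (f := Prod.fst) (t := univ) (by simp)]
  refine sum_congr rfl fun u _ => ?_
  refine card_bij' (fun x _ => x.2) (fun v _ => (u, v)) ?_ ?_ ?_ ?_
  · rintro ⟨a, b⟩ hx
    simp only [mem_filter, mem_univ, true_and] at hx ⊢
    exact hx.2 ▸ hx.1
  · intro v hv
    simpa using hv
  · rintro ⟨a, b⟩ hx
    simp only [mem_filter, mem_univ, true_and] at hx
    rw [← hx.2]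
  · simp

theorem sum_ite_singular (hF : ringChar F ≠ 2) (hn : n = 2 * k + 1)
    (hQ : Q.polarBilin.Nondegenerate) (c : ℕ) :
    ∑ u : Fin n → F, (if u ≠ 0 ∧ Q u = 0 then c else 0) = (Fintype.card F ^ (2 * k) - 1) * c := by
  rw [← sum_filter, sum_const, smul_eq_mul]
  congr 1
  rw [← card_singular hF hn hQ, ← card_erase_of_mem (s := {v | Q v = 0}) (a := 0) (by simp)]
  congr 1
  ext u
  simp

theorem card_hyperbolic_pairs (hF : ringChar F ≠ 2) (hk : 0 < k) (hn : n = 2 * k + 1)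
    (hQ : Q.polarBilin.Nondegenerate) :
    #{x : (Fin n → F) × (Fin n → F) | Q x.1 = 0 ∧ Q x.2 = 0 ∧ polar Q x.1 x.2 = 1} =
      (Fintype.card F ^ (2 * k) - 1) * Fintype.card F ^ (2 * k - 1) := by
  rw [sum_card_pairs fun u v => Q u = 0 ∧ Q v = 0 ∧ polar Q u v = 1, ← sum_ite_singular hF hn hQ]
  refine sum_congr rfl fun u _ => ?_
  split_ifs with hu
  · rw [← card_singular_polar_eq' hk hn hQ hu.1 hu.2 one_ne_zero]
    simp [hu.2]
  · rw [card_eq_zero, filter_eq_empty_iff]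
    rintro v - ⟨h1, -, h3⟩
    apply hu
    refine ⟨?_, h1⟩
    rintro rfl
    rw [polar_zero_left] at h3
    exact zero_ne_one h3

/-- The second summand comes from `u = 0`, which pairs with every singular `v`. -/
theorem card_totallySingular_pairs (hF : ringChar F ≠ 2) (hk : 0 < k) (hn : n = 2 * k + 1)
    (hQ : Q.polarBilin.Nondegenerate) :
    #{x : (Fin n → F) × (Fin n → F) | Q x.1 = 0 ∧ Q x.2 = 0 ∧ polar Q x.1 x.2 = 0} =
      (Fintype.card F ^ (2 * k) - 1) * Fintype.card F ^ (2 * k - 1) +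
        Fintype.card F ^ (2 * k) := by
  rw [sum_card_pairs fun u v => Q u = 0 ∧ Q v = 0 ∧ polar Q u v = 0, ← sum_ite_singular hF hn hQ,
    ← add_sum_erase _ _ (mem_univ (0 : Fin n → F)), ← add_sum_erase _ _ (mem_univ (0 : Fin n → F)),
    ← card_singular hF hn hQ]
  simp only [QuadraticMap.map_zero, polar_zero_left, ne_eq, not_true_eq_false, if_false,
    zero_add, and_true, true_and]
  rw [add_comm]
  congr 1
  refine sum_congr rfl fun u hu => ?_
  have hu0 := ne_of_mem_erase hu
  split_ifs with h
  · rw [← card_singular_polar_zero hF hk hn hQ h.1 h.2]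
    simp [h.2]
  · rw [card_eq_zero, filter_eq_empty_iff]
    rintro v - ⟨h1, -⟩
    exact h ⟨hu0, h1⟩

/-- Sum over `c = Q v`. Since `d` has character `-1`, the product of the counts for `d * c` and `c`
is a difference of squares, in which the unknown sign disappears. -/
theorem card_hermitian_pairs (hF : ringChar F ≠ 2) (hn : n = 2 * k + 1)
    (hQ : Q.polarBilin.Nondegenerate) {d : F} (hd : ¬IsSquare d) :
    (#{x : (Fin n → F) × (Fin n → F) | Q x.1 = d * Q x.2} : ℤ) =
      (Fintype.card F : ℤ) ^ (4 * k + 1) - (Fintype.card F - 1) * (Fintype.card F : ℤ) ^ (2 * k) := by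
  obtain ⟨s, hs, h⟩ := card_quadraticForm_eq hF hn Q hQ
  have h1 : #{x : (Fin n → F) × (Fin n → F) | Q x.1 = d * Q x.2} =
      ∑ c, #{u | Q u = d * c} * #{v | Q v = c} := by
    rw [card_eq_sum_card_fiberwise (f := fun x => Q x.2) (t := univ) (by simp)]
    refine sum_congr rfl fun c _ => ?_
    rw [← card_product]
    congr 1
    ext ⟨u, v⟩
    simp only [mem_filter, mem_univ, true_and, mem_product]
    constructor
    · rintro ⟨h1, rfl⟩
      exact ⟨h1, rfl⟩
    · rintro ⟨h1, rfl⟩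
      exact ⟨h1, rfl⟩
  have hs2 : s ^ 2 = 1 := by rcases hs with rfl | rfl <;> rfl
  have h2 : ∀ c : F, (#{u | Q u = d * c} * #{v | Q v = c} : ℤ) =
      (Fintype.card F : ℤ) ^ (4 * k) - (Fintype.card F : ℤ) ^ (2 * k) +
        if c = 0 then (Fintype.card F : ℤ) ^ (2 * k) else 0 := by
    intro c
    rw [h, h, map_mul, quadraticChar_neg_one_iff_not_isSquare.2 hd]
    split_ifs with hc
    · rw [hc, MulChar.map_zero]; ring
    · have := quadraticChar_sq_one hc
      linear_combination (-(Fintype.card F : ℤ) ^ (2 * k)) * (s ^ 2 * this + hs2)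
  rw [h1]
  push_cast
  simp only [h2, sum_add_distrib, sum_const, card_univ, nsmul_eq_mul]
  simp
  ring

/-- The `q ^ (2 * k - 1)` singular vectors orthogonal to `u` outnumber its `q` multiples; this is
where `r ≥ 4` enters. -/
theorem exists_totallySingular_pair (hF : ringChar F ≠ 2) (hk : 2 ≤ k) (hn : n = 2 * k + 1)
    (hQ : Q.polarBilin.Nondegenerate) : ∃ u v : Fin n → F, LinearIndependent F ![u, v] ∧
      Q u = 0 ∧ Q v = 0 ∧ polar Q u v = 0 := by
  have hc : 1 < Fintype.card F := Fintype.one_lt_card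
  obtain ⟨u, hu, hu0⟩ : ∃ u ∈ ({v | Q v = 0} : Finset (Fin n → F)), u ≠ 0 := by
    apply exists_mem_ne
    rw [card_singular hF hn hQ]
    exact Nat.one_lt_pow (by omega) hc
  have hu := (mem_filter.1 hu).2
  obtain ⟨v, hv, hv'⟩ : ∃ v ∈ ({v | Q v = 0 ∧ polar Q u v = 0} : Finset (Fin n → F)),
      v ∉ univ.image fun t : F => t • u := by
    apply exists_mem_notMem_of_card_lt_card
    rw [card_singular_polar_zero hF (by omega) hn hQ hu0 hu]
    refine lt_of_le_of_lt card_image_le ?_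
    rw [card_univ]
    exact lt_self_pow₀ hc (by omega)
  have hv := (mem_filter.1 hv).2
  refine ⟨u, v, ?_, hu, hv.1, hv.2⟩
  rw [LinearIndependent.pair_iff' hu0]
  intro a ha
  exact hv' (mem_image.2 ⟨a, mem_univ _, ha⟩)

end PairCounting

/-! ### From pairs of vectors to numbers of points. -/

section PointCounting

open Finset
open QuadraticMap (polar polar_zero_left)

variable {F K : Type*} [Field F] [Field K] [Algebra F K]
  {n k : ℕ} {Q : QuadraticForm F (Fin n → F)} {d : F} {e : K}

theorem ncard_cast_eq {q r N : ℕ} (hq : 1 < q) (h : 2 * N = (q ^ r - 1) * q ^ (r - 1)) :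
    (N : ℚ) = (q : ℚ) ^ (r - 1) * ((q : ℚ) ^ r - 1) / 2 := by
  have p : 1 ≤ q ^ r := Nat.one_le_pow _ _ (by omega)
  have h1 := congrArg (Nat.cast : ℕ → ℚ) h
  push_cast [p] at h1
  linear_combination h1 / 2

namespace IsQuadGen

theorem card_eq_mul_ncard [Finite K] (S : Finset ((Fin n → F) × (Fin n → F)))
    (X : Set (ℙ K (Fin n → K))) (m : ℕ)
    (hS : ∀ p ∈ S, ∃ hx : comb e p.1 p.2 ≠ 0, Projectivization.mk K _ hx ∈ X)
    (hX : ∀ P ∈ X, {p : (Fin n → F) × (Fin n → F) | p ∈ S ∧ ∃ hx : comb e p.1 p.2 ≠ 0,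
      Projectivization.mk K _ hx = P}.ncard = m) : #S = m * X.ncard := by
  classical
  have hfin : X.Finite := Set.toFinite X
  rw [Set.ncard_eq_toFinset_card X hfin]
  have := Finset.card_mul_eq_card_mul (s := S) (t := hfin.toFinset) (m := 1) (n := m)
    (fun p P => ∃ hx : comb e p.1 p.2 ≠ 0, Projectivization.mk K _ hx = P) ?_ ?_
  · rw [mul_one] at this
    rw [this, mul_comm]
  · intro p hp
    obtain ⟨hx, hpX⟩ := hS p hp
    rw [card_eq_one]
    refine ⟨Projectivization.mk K _ hx, ?_⟩
    ext P
    simp only [mem_bipartiteAbove, Set.Finite.mem_toFinset, mem_singleton]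
    constructor
    · rintro ⟨-, -, rfl⟩
      rfl
    · rintro rfl
      exact ⟨hpX, hx, rfl⟩
  · intro P hP
    rw [← hX P (hfin.mem_toFinset.1 hP), ← Set.ncard_coe_finset]
    congr 1
    ext p
    simp

variable [Fintype F] [DecidableEq F]

theorem setQ_nonempty_and_setO_nonempty (h : IsQuadGen d e) (hF : ringChar F ≠ 2) (hk : 2 ≤ k)
    (hn : n = 2 * k + 1) (hQ : Q.polarBilin.Nondegenerate) :
    (setQ K Q).Nonempty ∧ (setO K Q).Nonempty := by
  obtain ⟨u, v, hi, hu, hv, huv⟩ := exists_totallySingular_pair hF hk hn hQ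
  have hu0 : u ≠ 0 := hi.ne_zero 0
  have hx : comb e u v ≠ 0 := by
    intro hx
    rw [← comb_zero (F := F) (e := e)] at hx
    exact hu0 (h.comb_injective hx).1
  refine ⟨⟨_, _, (mk_mem_quadric hu0).2 hu, rfl⟩,
    ⟨_, (h.mk_mem_setO hx).2 ⟨by rw [hu, hv, mul_zero], hi, ?_⟩⟩⟩
  rw [disc, hu, huv]; ring

variable [Finite K]

/-- Rescaling to the Gram matrix of a hyperbolic pair, supplied by `hne`, gives each point a
normalised representative. It is unique up to sign: both representatives have `B(x, x) = 2 * e`, so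
the factor `z` between them satisfies `z ^ 2 = 1`. -/
theorem two_mul_ncard_setS (h : IsQuadGen d e)
    (hne : ({x | Q x.1 = 0 ∧ Q x.2 = 0 ∧ polar Q x.1 x.2 = 1} :
      Finset ((Fin n → F) × (Fin n → F))).Nonempty) :
    #{x : (Fin n → F) × (Fin n → F) | Q x.1 = 0 ∧ Q x.2 = 0 ∧ polar Q x.1 x.2 = 1} =
      2 * (setS K Q).ncard := by
  have hyp : ∀ u v : Fin n → F, Q u = 0 → Q v = 0 → polar Q u v = 1 →
      Q u = d * Q v ∧ disc Q u v = 1 ∧ u ≠ 0 ∧ comb e u v ≠ 0 := by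
    intro u v hu hv huv
    have hu0 : u ≠ 0 := by
      rintro rfl
      rw [polar_zero_left] at huv
      exact zero_ne_one huv
    refine ⟨by rw [hu, hv, mul_zero], by rw [disc, hu, hv, huv]; ring, hu0, ?_⟩
    intro hx
    rw [← comb_zero (F := F) (e := e)] at hx
    exact hu0 (h.comb_injective hx).1
  refine card_eq_mul_ncard (e := e) _ _ _ ?_ ?_
  · rintro ⟨u, v⟩ hp
    obtain ⟨hu, hv, huv⟩ := (mem_filter.1 hp).2
    obtain ⟨hq, hd, -, hx⟩ := hyp u v hu hv huv
    refine ⟨hx, (h.mk_mem_setS hx).2 ⟨hq, ?_, ?_⟩⟩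
    · rw [hd]; exact .one
    · rw [hd]; exact one_ne_zero
  · intro P hP
    obtain ⟨u, v, hx, hu, hv, huv, rfl⟩ : ∃ (u v : Fin n → F) (hx : comb e u v ≠ 0),
        Q u = 0 ∧ Q v = 0 ∧ polar Q u v = 1 ∧ Projectivization.mk K _ hx = P := by
      revert P
      refine h.ind fun u v hx hP => ?_
      obtain ⟨hq, hs, hd⟩ := (h.mk_mem_setS hx).1 hP
      obtain ⟨⟨u₀, v₀⟩, hp⟩ := hne
      obtain ⟨hu, hv, huv⟩ := (mem_filter.1 hp).2
      obtain ⟨hq₀, hd₀, -, -⟩ := hyp u₀ v₀ hu hv huv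
      obtain ⟨z, u₁, v₁, hz0, hz, h1, h3, h4⟩ := h.exists_smul_comb_eq hq hq₀ hd
        (by rw [hd₀]; exact one_ne_zero) (by rw [hd₀, mul_one]; exact hs)
      have hx₁ : comb e u₁ v₁ ≠ 0 := by
        rw [← hz]
        exact smul_ne_zero hz0 hx
      exact ⟨u₁, v₁, hx₁, h1.trans hu, h3.trans hv, h4.trans huv,
        (Projectivization.mk_eq_mk_iff' ..).2 ⟨_, hz⟩⟩
    obtain ⟨hq, hd, hu0, -⟩ := hyp u v hu hv huv
    rw [Set.ncard_eq_two]
    refine ⟨(u, v), (-u, -v), ?_, ?_⟩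
    · intro h1
      have h3 : u = -u := congrArg Prod.fst h1
      apply hu0
      apply smul_right_injective _ h.two_ne_zero
      change (2 : F) • u = (2 : F) • 0
      rw [two_smul, smul_zero]
      nth_rw 2 [h3]
      rw [add_neg_cancel]
    · ext ⟨u', v'⟩
      simp only [mem_filter, mem_univ, true_and, Set.mem_ofPred_eq, Set.mem_insert_iff,
        Set.mem_singleton_iff, Prod.mk.injEq]
      constructor
      · rintro ⟨⟨hu', hv', huv'⟩, hx', he⟩
        obtain ⟨z, hz⟩ := (Projectivization.mk_eq_mk_iff' ..).1 he
        have e0 : e ≠ 0 := by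
          rintro rfl
          have := h.sq_eq
          rw [zero_pow (by norm_num), eq_comm, map_eq_zero] at this
          exact h.not_isSquare (this ▸ .zero)
        have t0 : algebraMap F K 2 ≠ 0 := by simpa using h.two_ne_zero
        have h1 := h.polarExt_self Q u' v'
        rw [← hz, map_smul, map_smul, LinearMap.smul_apply, h.polarExt_self, hu, hv, hu', hv', huv,
          huv'] at h1
        simp only [mul_zero, add_zero, mul_one, map_zero, zero_add, smul_eq_mul] at h1
        have h3 : z * z = 1 := by
          apply mul_right_cancel₀ (mul_ne_zero e0 t0)
          linear_combination h1
        rcases mul_self_eq_one_iff.1 h3 with rfl | rfl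
        · rw [one_smul] at hz
          obtain ⟨rfl, rfl⟩ := h.comb_injective hz
          simp
        · have : comb e (-u) (-v) = comb e u' v' := by
            rw [← hz]
            simp [comb]
          obtain ⟨rfl, rfl⟩ := h.comb_injective this
          simp
      · rintro (⟨rfl, rfl⟩ | ⟨rfl, rfl⟩)
        · exact ⟨⟨hu, hv, huv⟩, hx, rfl⟩
        · have e1 : comb e (-u) (-v) = (-1 : K) • comb e u v := by
            simp [comb]
          refine ⟨⟨by rw [QuadraticMap.map_neg, hu], by rw [QuadraticMap.map_neg, hv], by
            rw [QuadraticMap.polar_neg_left, QuadraticMap.polar_neg_right, neg_neg, huv]⟩, ?_,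
            (Projectivization.mk_eq_mk_iff' ..).2 ⟨-1, e1.symm⟩⟩
          rw [e1]
          exact smul_ne_zero (by simp) hx

theorem mul_ncard_setE_union_setS (h : IsQuadGen d e) :
    #{x : (Fin n → F) × (Fin n → F) | Q x.1 = d * Q x.2 ∧ disc Q x.1 x.2 ≠ 0} =
      (Nat.card K - 1) * (setE K Q ∪ setS K Q).ncard := by
  classical
  have := Fintype.ofFinite K
  have hmem : ∀ {u v : Fin n → F} (hx : comb e u v ≠ 0),
      Projectivization.mk K _ hx ∈ setE K Q ∪ setS K Q ↔ Q u = d * Q v ∧ disc Q u v ≠ 0 := by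
    intro u v hx
    rw [Set.mem_union, h.mk_mem_setE, h.mk_mem_setS]
    have h3 : disc Q u v = 0 → IsSquare (disc Q u v) := fun h3 => h3 ▸ .zero
    tauto
  refine card_eq_mul_ncard (e := e) _ _ _ ?_ ?_
  · rintro ⟨u, v⟩ hp
    have hp := (mem_filter.1 hp).2
    have hx : comb e u v ≠ 0 := by
      intro hx
      rw [← comb_zero (F := F) (e := e)] at hx
      obtain ⟨rfl, rfl⟩ := h.comb_injective hx
      exact hp.2 (by simp [disc])
    exact ⟨hx, (hmem hx).2 hp⟩
  · refine h.ind fun u v hx hP => ?_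
    -- `f` and `g` pick out the two parts of a vector, so the pairs representing the point are
    -- parametrised by its nonzero `K`-multiples.
    choose f g hfg using h.exists_comb (n := n)
    have hS : {p : (Fin n → F) × (Fin n → F) | p ∈ ({x | Q x.1 = d * Q x.2 ∧ disc Q x.1 x.2 ≠ 0} :
        Finset ((Fin n → F) × (Fin n → F))) ∧ ∃ hx' : comb e p.1 p.2 ≠ 0,
        Projectivization.mk K _ hx' = Projectivization.mk K _ hx} =
        (fun z : K => (f (z • comb e u v), g (z • comb e u v))) '' {0}ᶜ := by
      ext ⟨u', v'⟩
      simp only [mem_filter, mem_univ, true_and, Set.mem_ofPred_eq, Set.mem_image, Prod.mk.injEq,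
        Set.mem_compl_iff, Set.mem_singleton_iff]
      constructor
      · rintro ⟨-, hx', he⟩
        obtain ⟨z, hz⟩ := (Projectivization.mk_eq_mk_iff' ..).1 he
        refine ⟨z, ?_, ?_⟩
        · rintro rfl
          rw [zero_smul] at hz
          exact hx' hz.symm
        · obtain ⟨h1, h3⟩ := h.comb_injective (hz.symm.trans (hfg _))
          exact ⟨h1.symm, h3.symm⟩
      · rintro ⟨z, hz, rfl, rfl⟩
        have hx' : comb e (f (z • comb e u v)) (g (z • comb e u v)) ≠ 0 := by
          rw [← hfg]
          exact smul_ne_zero hz hx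
        have he : Projectivization.mk K _ hx' = Projectivization.mk K _ hx :=
          (Projectivization.mk_eq_mk_iff' ..).2 ⟨z, hfg _⟩
        refine ⟨(hmem hx').1 ?_, hx', he⟩
        rw [he]
        exact hP
    rw [hS, Set.ncard_image_of_injective]
    · rw [Set.ncard_compl, Set.ncard_singleton]
    · intro z z' hz
      obtain ⟨h1, h3⟩ := Prod.mk.inj hz
      have : z • comb e u v = z' • comb e u v := by
        rw [hfg (z • comb e u v), hfg (z' • comb e u v), h1, h3]
      exact smul_left_injective K hx this

theorem ncard_setE_union_setS (h : IsQuadGen d e) (hF : ringChar F ≠ 2) (hk : 0 < k)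
    (hn : n = 2 * k + 1) (hQ : Q.polarBilin.Nondegenerate) :
    (setE K Q ∪ setS K Q).ncard =
      (Fintype.card F ^ (2 * k) - 1) * Fintype.card F ^ (2 * k - 1) := by
  have h1 := card_hermitian_pairs hF hn hQ h.not_isSquare
  have h3 := card_totallySingular_pairs hF hk hn hQ
  have h4 := h.mul_ncard_setE_union_setS (Q := Q)
  -- Among all Hermitian pairs, including `(0, 0)`, those of zero discriminant are exactly the
  -- totally singular ones.
  have h5 : #{x : (Fin n → F) × (Fin n → F) | Q x.1 = d * Q x.2} =
      #{x : (Fin n → F) × (Fin n → F) | Q x.1 = 0 ∧ Q x.2 = 0 ∧ polar Q x.1 x.2 = 0} +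
      #{x : (Fin n → F) × (Fin n → F) | Q x.1 = d * Q x.2 ∧ disc Q x.1 x.2 ≠ 0} := by
    rw [← card_filter_add_card_filter_not (s := {x : (Fin n → F) × (Fin n → F) | Q x.1 = d * Q x.2})
      (fun x => disc Q x.1 x.2 = 0), filter_filter, filter_filter]
    congr 2
    ext ⟨u, v⟩
    simp only [mem_filter, mem_univ, true_and]
    constructor
    · rintro ⟨hq, hd⟩
      exact eq_zero_of_disc_eq_zero h.two_ne_zero h.not_isSquare hq hd
    · rintro ⟨hu, hv, huv⟩
      exact ⟨by rw [hu, hv, mul_zero], by rw [disc, hu, huv]; ring⟩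
  rw [h5, h4, h3, h.card_eq, Nat.card_eq_fintype_card] at h1
  have hc : 1 < Fintype.card F := Fintype.one_lt_card
  obtain ⟨j, rfl⟩ : ∃ j, k = j + 1 := ⟨k - 1, by omega⟩
  rw [show 2 * (j + 1) - 1 = 2 * j + 1 by omega] at h1 ⊢
  have p1 : 1 ≤ Fintype.card F ^ (2 * (j + 1)) := Nat.one_le_pow _ _ (by omega)
  have p2 : 1 ≤ Fintype.card F ^ 2 := Nat.one_le_pow _ _ (by omega)
  zify [p1]
  push_cast [p1, p2] at h1
  generalize (setE K Q ∪ setS K Q).ncard = N at h1 ⊢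
  have hc' : ((Fintype.card F : ℤ)) ^ 2 - 1 ≠ 0 := by
    have : (1 : ℤ) < Fintype.card F := by exact_mod_cast hc
    nlinarith
  apply mul_left_cancel₀ hc'
  linear_combination h1

theorem ncard_setS (h : IsQuadGen d e) (hF : ringChar F ≠ 2) (hk : 0 < k)
    (hn : n = 2 * k + 1) (hQ : Q.polarBilin.Nondegenerate) :
    2 * (setS K Q).ncard = (Fintype.card F ^ (2 * k) - 1) * Fintype.card F ^ (2 * k - 1) := by
  have hc := card_hyperbolic_pairs hF hk hn hQ
  rw [← hc, h.two_mul_ncard_setS]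
  rw [← card_pos, hc]
  have : 1 < Fintype.card F := Fintype.one_lt_card
  exact Nat.mul_pos (Nat.sub_pos_of_lt (Nat.one_lt_pow (by omega) this)) (pow_pos (by omega) _)

theorem ncard_setE (h : IsQuadGen d e) (hF : ringChar F ≠ 2) (hk : 0 < k)
    (hn : n = 2 * k + 1) (hQ : Q.polarBilin.Nondegenerate) :
    2 * (setE K Q).ncard = (Fintype.card F ^ (2 * k) - 1) * Fintype.card F ^ (2 * k - 1) := by
  have h1 := h.ncard_setS hF hk hn hQ
  have h3 := h.ncard_setE_union_setS hF hk hn hQ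
  rw [Set.ncard_union_eq h.disjoint_sets.2.2.2.2.2] at h3
  omega

end IsQuadGen

end PointCounting

end ParabolicHermitian

/-! ### The orbit theorem. -/

theorem mainTheorem8 {F : Type*} {K : Type*} [Field F] [Finite F] [Field K] [Algebra F K]
    (q r : ℕ) (hF : Nat.card F = q) (hK : Nat.card K = q ^ 2) (hq : Odd q)
    (hr : 4 ≤ r) (hr' : Even r)
    (Q : QuadraticForm F (Fin (r + 1) → F)) (hQ : Q.polarBilin.Nondegenerate) :
    (∀ g ∈ ParabolicHermitian.groupG K Q, ∀ P ∈ ParabolicHermitian.hermitian K Q,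
      g • P ∈ ParabolicHermitian.hermitian K Q) ∧
    {X : Set (ℙ K (Fin (r + 1) → K)) | ∃ P ∈ ParabolicHermitian.hermitian K Q,
        X = MulAction.orbit (ParabolicHermitian.groupG K Q) P} =
      {ParabolicHermitian.setQ K Q, ParabolicHermitian.setO K Q,
        ParabolicHermitian.setE K Q, ParabolicHermitian.setS K Q} ∧
    ({ParabolicHermitian.setQ K Q, ParabolicHermitian.setO K Q,
        ParabolicHermitian.setE K Q, ParabolicHermitian.setS K Q} :
      Set (Set (ℙ K (Fin (r + 1) → K)))).ncard = 4 ∧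
    ((ParabolicHermitian.setS K Q).ncard : ℚ) = (q : ℚ) ^ (r - 1) * ((q : ℚ) ^ r - 1) / 2 ∧
    ((ParabolicHermitian.setE K Q).ncard : ℚ) = (q : ℚ) ^ (r - 1) * ((q : ℚ) ^ r - 1) / 2 := by
  classical
  have := Fintype.ofFinite F
  subst hF
  have : Finite K := Nat.finite_of_card_ne_zero (by rw [hK]; exact pow_ne_zero _ Nat.card_pos.ne')
  have hF := ParabolicHermitian.ringChar_ne_two_of_odd hq
  obtain ⟨d, e, h⟩ := ParabolicHermitian.exists_isQuadGen hK hq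
  obtain ⟨k, hk⟩ := hr'
  rw [← two_mul] at hk
  subst hk
  have hc : 1 < Nat.card F := by rw [Nat.card_eq_fintype_card]; exact Fintype.one_lt_card
  have hS := h.ncard_setS hF (by omega : 0 < k) rfl hQ
  have hE := h.ncard_setE hF (by omega : 0 < k) rfl hQ
  rw [← Nat.card_eq_fintype_card] at hS hE
  have hpos : 0 < (Nat.card F ^ (2 * k) - 1) * Nat.card F ^ (2 * k - 1) :=
    Nat.mul_pos (Nat.sub_pos_of_lt (Nat.one_lt_pow (by omega) hc)) (pow_pos (by omega) _)
  -- Nonemptiness of `setS` and `setE` follows from their positive sizes; nonempty disjoint sets are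
  -- distinct, which gives exactly four orbits.
  have nS : (ParabolicHermitian.setS K Q).Nonempty :=
    Set.nonempty_of_ncard_ne_zero (by omega)
  have nE : (ParabolicHermitian.setE K Q).Nonempty :=
    Set.nonempty_of_ncard_ne_zero (by omega)
  obtain ⟨nQ, nO⟩ := h.setQ_nonempty_and_setO_nonempty hF (by omega : 2 ≤ k) rfl hQ
  have oQ : ∀ P ∈ ParabolicHermitian.setQ K Q, _ := fun P hP =>
    ParabolicHermitian.orbit_eq (fun γ hγ P => (h.smul_mem_iff hγ P).2.1)
      (h.exists_smul_eq_setQ hQ) hP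
  have oO : ∀ P ∈ ParabolicHermitian.setO K Q, _ := fun P hP =>
    ParabolicHermitian.orbit_eq (fun γ hγ P => (h.smul_mem_iff hγ P).2.2.1)
      (h.exists_smul_eq_setO hQ) hP
  have oE : ∀ P ∈ ParabolicHermitian.setE K Q, _ := fun P hP =>
    ParabolicHermitian.orbit_eq (fun γ hγ P => (h.smul_mem_iff hγ P).2.2.2.1)
      h.exists_smul_eq_setE hP
  have oS : ∀ P ∈ ParabolicHermitian.setS K Q, _ := fun P hP =>
    ParabolicHermitian.orbit_eq (fun γ hγ P => (h.smul_mem_iff hγ P).2.2.2.2)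
      h.exists_smul_eq_setS hP
  refine ⟨fun g hg P hP => (h.smul_mem_iff hg P).1.2 hP, ?_, ?_,
    ParabolicHermitian.ncard_cast_eq hc hS,
    ParabolicHermitian.ncard_cast_eq hc hE⟩
  · ext X
    simp only [Set.mem_ofPred_eq, Set.mem_insert_iff, Set.mem_singleton_iff]
    constructor
    · rintro ⟨P, hP, rfl⟩
      rcases (h.mem_hermitian_iff P).1 hP with hP | hP | hP | hP
      · exact .inl (oQ P hP)
      · exact .inr (.inl (oO P hP))
      · exact .inr (.inr (.inl (oE P hP)))
      · exact .inr (.inr (.inr (oS P hP)))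
    · rintro (rfl | rfl | rfl | rfl)
      · obtain ⟨P, hP⟩ := nQ
        exact ⟨P, (h.mem_hermitian_iff P).2 (.inl hP), (oQ P hP).symm⟩
      · obtain ⟨P, hP⟩ := nO
        exact ⟨P, (h.mem_hermitian_iff P).2 (.inr (.inl hP)), (oO P hP).symm⟩
      · obtain ⟨P, hP⟩ := nE
        exact ⟨P, (h.mem_hermitian_iff P).2 (.inr (.inr (.inl hP))), (oE P hP).symm⟩
      · obtain ⟨P, hP⟩ := nS
        exact ⟨P, (h.mem_hermitian_iff P).2 (.inr (.inr (.inr hP))), (oS P hP).symm⟩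
  · obtain ⟨d1, d2, d3, d4, d5, d6⟩ := h.disjoint_sets (Q := Q)
    have n1 := d1.ne nQ.ne_empty
    have n2 := d2.ne nQ.ne_empty
    have n3 := d3.ne nQ.ne_empty
    have n4 := d4.ne nO.ne_empty
    have n5 := d5.ne nO.ne_empty
    have n6 := d6.ne nE.ne_empty
    rw [Set.ncard_insert_of_notMem (by simp [n1, n2, n3]),
      Set.ncard_insert_of_notMem (by simp [n4, n5]), Set.ncard_pair n6]
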